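/- Let $\mathcal{D}_n$ be the Dyck lattice of order $n$: the Dyck paths of semilength $n$ (words $\gamma$ in the steps $u=(1,1)$, $d=(1,-1)$, from $(0,0)$ to $(2n,0)$, never going below the $x$-axis), ordered by $\gamma\le\gamma'$ iff $\gamma$ lies weakly below $\gamma'$. Let $sc_h(\mathcal{D}_n)$ be the number of saturated chains $\gamma^{(0)}<\gamma^{(1)}<\cdots<\gamma^{(h)}$ of length $h$ in $\mathcal{D}_n$, i.e. such that $\gamma^{(i+1)}$ covers $\gamma^{(i)}$ for every $i$. A skew Ferrers shape $\varphi$ is a nonempty shape obtained from a Ferrers shape by removing a (possibly empty) Ferrers shape from its top-left corner, such that any two consecutive rows have a common column and any two consecutive columns have a common row. Write $SkFS$ for the set of skew Ferrers shapes, and for $\varphi\in SkFS$ let - $A(\varphi)$ be its area, i.e. its number of cells; - $b(\varphi)$ be its lower border: the shape is delimited by two paths from its bottom-left to its top-right corner, each encoded as a word by writing $d$ for a horizontal and $u$ for a vertical unit step, and $b(\varphi)$ is the one of these words whose first letter is $d$; - $t(\varphi)$ be the number of skew Young tableaux of shape $\varphi$, i.e. of fillings of the cells with the distinct integers $1,\ldots,A(\varphi)$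 that are strictly decreasing along each row (from left to right) and each column (from top to bottom). Then for all integers $n,h\ge 0$ $$sc_h(\mathcal{D}_n)=\sum_{\gamma\in\mathcal{D}_n}\ \sum_{\lambda\vdash h}\ \sum_{(\gamma_1,\ldots,\gamma_k)}\ \sum_{(\varphi_1,\ldots,\varphi_k)}\binom{h}{A(\varphi_1),\ldots,A(\varphi_k)}\,t(\varphi_1)\cdots t(\varphi_k).$$ Here $\lambda=(\lambda_1\ge\cdots\ge\lambda_k)$ runs over the partitions of $h$. The third sum runs over the families $(\gamma_1,\ldots,\gamma_k)$ of occurrences of factors (blocks of consecutive steps, together with their position) of $\gamma$ such that no two of them share a step and, for each $i$, there is $\varphi\in SkFS$ with $b(\varphi)=\gamma_i$ and $A(\varphi)=\lambda_i$; such families are unordered, i.e. two families that differ only by a permutation of the occurrences belonging to equal parts of $\lambda$ are counted once (equivalently, if $\lambda_i=\lambda_j$ with $i<j$, then $\gamma_i$ is required to start to the left of $\gamma_j$). The fourth sum runs over all $k$-tuples $(\varphi_1,\ldots,\varphi_k)\in SkFS^k$ with $b(\varphi_i)=\gamma_i$ and $A(\varphi_i)=\lambda_i$ for all $i$. -/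

import Mathlib

open Finset BigOperators

noncomputable section

/-! ### Saturated chains -/

/-- `saturatedChainCount P h` is the number of saturated chains `c 0 ⋖ c 1 ⋖ ⋯ ⋖ c h` of
length `h` in the poset `P` (meant for finite `P`). -/
def saturatedChainCount (P : Type*) [PartialOrder P] (h : ℕ) : ℕ :=
  Nat.card {c : Fin (h + 1) → P // ∀ i : Fin h, c i.castSucc ⋖ c i.succ}

/-! ### Dyck lattices -/

/-- The height (ordinate) reached by a path after its first `i` steps, where `U = (1, 1)` and
`D = (1, -1)`. -/
def pathHeight (w : List DyckStep) (i : ℕ) : ℤ :=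
  ((w.take i).count DyckStep.U : ℤ) - ((w.take i).count DyckStep.D : ℤ)

/-- Dyck paths of semilength `n`. -/
def DyckPath (n : ℕ) : Type := {w : DyckWord // w.semilength = n}

namespace DyckPath

variable {n : ℕ}

/-- The sequence of steps of a Dyck path. -/
def steps (γ : DyckPath n) : List DyckStep := γ.1.toList

instance : Fintype (DyckPath n) :=
  inferInstanceAs (Fintype {w : DyckWord // w.semilength = n})

theorem length_steps (γ : DyckPath n) : γ.steps.length = 2 * n := by
  have h := γ.1.two_mul_semilength_eq_length
  rw [γ.2] at h
  exact h.symm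

theorem steps_injective : Function.Injective (steps : DyckPath n → List DyckStep) :=
  fun _ _ h => Subtype.ext (DyckWord.ext h)

theorem pathHeight_cons_succ (s : DyckStep) (w : List DyckStep) (i : ℕ) :
    pathHeight (s :: w) (i + 1) = pathHeight [s] 1 + pathHeight w i := by
  cases s <;> simp [pathHeight] <;> ring

theorem eq_of_pathHeight_eq : ∀ v w : List DyckStep, v.length = w.length →
    (∀ i, pathHeight v i = pathHeight w i) → v = w
  | [], [], _, _ => rfl
  | [], _ :: _, h, _ => by simp at h
  | _ :: _, [], h, _ => by simp at h
  | s :: v, t :: w, h, hh => by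
    have h1 : pathHeight [s] 1 = pathHeight [t] 1 := by
      have := hh 1
      rw [← zero_add 1, pathHeight_cons_succ, pathHeight_cons_succ] at this
      simpa [pathHeight] using this
    have hst : s = t := by
      cases s <;> cases t <;> simp [pathHeight] at h1 ⊢
    have hvw : v = w := by
      refine eq_of_pathHeight_eq v w (by simpa using h) fun i => ?_
      have := hh (i + 1)
      rw [pathHeight_cons_succ s v, pathHeight_cons_succ t w] at this
      omega
    rw [hst, hvw]

/-- The order of the Dyck lattice: `γ ≤ γ'` when `γ` lies weakly below `γ'`. -/
instance : PartialOrder (DyckPath n) where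
  le γ γ' := ∀ i, pathHeight γ.steps i ≤ pathHeight γ'.steps i
  le_refl _ _ := le_rfl
  le_trans _ _ _ h h' i := (h i).trans (h' i)
  le_antisymm γ γ' h h' := steps_injective <|
    eq_of_pathHeight_eq _ _ (by rw [length_steps, length_steps])
      fun i => le_antisymm (h i) (h' i)

end DyckPath

/-! ### Skew Ferrers shapes and skew Young tableaux -/

/-- A (nonempty) skew Ferrers shape: a Ferrers shape `outer` with a Ferrers shape `inner` removed
from its top-left corner, such that any two consecutive rows have a common column and any two
consecutive columns have a common row. Cells are pairs (row, column), rows being numbered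
downwards from `0` and columns rightwards from `0`. The rows and columns are those of `outer`. -/
structure SkewFerrersShape where
  outer : YoungDiagram
  inner : YoungDiagram
  inner_le : inner ≤ outer
  nonempty : (outer.cells \ inner.cells).Nonempty
  rows_connected : ∀ i, i + 1 < outer.colLen 0 →
    ∃ j, (i, j) ∈ outer.cells \ inner.cells ∧ (i + 1, j) ∈ outer.cells \ inner.cells
  cols_connected : ∀ j, j + 1 < outer.rowLen 0 →
    ∃ i, (i, j) ∈ outer.cells \ inner.cells ∧ (i, j + 1) ∈ outer.cells \ inner.cells

/-- `borderWord p [r₁, …, rₘ]`, for `p ≤ r₁ ≤ ⋯ ≤ rₘ`: the path which starts at abscissa `p` and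
climbs, by one vertical step each, along the right ends of rows of lengths `r₁, …, rₘ` (listed
from bottom to top), going right by horizontal steps before each vertical step as needed.
A horizontal step is written `D` and a vertical step is written `U`. -/
def borderWord : ℕ → List ℕ → List DyckStep
  | _, [] => []
  | p, r :: rs => List.replicate (r - p) DyckStep.D ++ DyckStep.U :: borderWord r rs

namespace SkewFerrersShape

/-- The set of cells. -/
def cells (φ : SkewFerrersShape) : Finset (ℕ × ℕ) := φ.outer.cells \ φ.inner.cells

/-- The area `A(φ)`: the number of cells. -/
def area (φ : SkewFerrersShape) : ℕ := φ.cells.card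

/-- The lower border `b(φ)`: of the two paths that delimit `φ` from its bottom-left to its
top-right corner, the one which begins with a horizontal step `D`, i.e. the one which follows the
boundary of `outer`. -/
def lowerBorder (φ : SkewFerrersShape) : List DyckStep := borderWord 0 φ.outer.rowLens.reverse

/-- A skew Young tableau of shape `φ`: the cells are filled with the distinct integers
`1, …, A(φ)`, decreasing along each row (left to right) and each column (top to bottom). -/
structure IsTableau (φ : SkewFerrersShape) (T : φ.cells → ℕ) : Prop where
  injective : Function.Injective T
  range_eq : Set.range T = Set.Icc 1 φ.area
  row_decreasing : ∀ c d : φ.cells, c.1.1 = d.1.1 → c.1.2 < d.1.2 → T d < T c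
  col_decreasing : ∀ c d : φ.cells, c.1.2 = d.1.2 → c.1.1 < d.1.1 → T d < T c

/-- `t(φ)`: the number of skew Young tableaux of shape `φ`. -/
def tableauCount (φ : SkewFerrersShape) : ℕ := Nat.card {T : φ.cells → ℕ // φ.IsTableau T}

end SkewFerrersShape

/-- The set of the skew Ferrers shapes `φ` with `b(φ) = w` and `A(φ) = m`. -/
def ShapesOn (w : List DyckStep) (m : ℕ) : Type :=
  {φ : SkewFerrersShape // φ.lowerBorder = w ∧ φ.area = m}

theorem count_U_borderWord (p : ℕ) (l : List ℕ) :
    (borderWord p l).count DyckStep.U = l.length := by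
  induction l generalizing p with
  | nil => rfl
  | cons r rs ih => simp [borderWord, ih, List.count_replicate]

theorem le_count_D_borderWord (p : ℕ) (l : List ℕ) :
    ∀ r ∈ l, r ≤ p + (borderWord p l).count DyckStep.D := by
  induction l generalizing p with
  | nil => simp
  | cons a l ih =>
    intro r hr
    simp only [borderWord, List.count_append, List.count_replicate_self, List.count_cons]
    rcases List.mem_cons.1 hr with rfl | hr
    · omega
    · have := ih a r hr
      omega

theorem SkewFerrersShape.outer_cells_subset (φ : SkewFerrersShape) :
    φ.outer.cells ⊆ range (φ.lowerBorder.count DyckStep.U) ×ˢ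
      range (φ.lowerBorder.count DyckStep.D) := by
  rintro ⟨i, j⟩ hc
  have hc' : (i, j) ∈ φ.outer := (YoungDiagram.mem_cells _).1 hc
  have hi : i < φ.outer.rowLens.length := by
    rw [YoungDiagram.length_rowLens]
    exact YoungDiagram.mem_iff_lt_colLen.1 (φ.outer.up_left_mem le_rfl (Nat.zero_le j) hc')
  have hj : j < φ.outer.rowLens[i] := by
    rw [YoungDiagram.get_rowLens]
    exact YoungDiagram.mem_iff_lt_rowLen.1 hc'
  have hle := le_count_D_borderWord 0 φ.outer.rowLens.reverse φ.outer.rowLens[i]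
    (List.mem_reverse.2 (List.getElem_mem hi))
  rw [mem_product, mem_range, mem_range, lowerBorder, count_U_borderWord, List.length_reverse]
  exact ⟨hi, by omega⟩

instance (w : List DyckStep) (m : ℕ) : Finite (ShapesOn w m) := by
  let B := range (w.count DyckStep.U) ×ˢ range (w.count DyckStep.D)
  have key : ∀ φ : ShapesOn w m, φ.1.outer.cells ∈ B.powerset := fun φ => by
    have h := φ.1.outer_cells_subset
    rw [φ.2.1] at h
    exact mem_powerset.2 h
  have key' : ∀ φ : ShapesOn w m, φ.1.inner.cells ∈ B.powerset := fun φ =>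
    mem_powerset.2 ((YoungDiagram.cells_subset_iff.2 φ.1.inner_le).trans
      (mem_powerset.1 (key φ)))
  let f : ShapesOn w m → B.powerset × B.powerset :=
    fun φ => (⟨φ.1.outer.cells, key φ⟩, ⟨φ.1.inner.cells, key' φ⟩)
  refine Finite.of_injective f ?_
  rintro ⟨⟨o, i, _, _, _, _⟩, _⟩ ⟨⟨o', i', _, _, _, _⟩, _⟩ h
  simp only [f, Prod.mk.injEq, Subtype.mk.injEq] at h
  obtain ⟨h1, h2⟩ := h
  have ho : o = o' := YoungDiagram.ext h1
  have hi : i = i' := YoungDiagram.ext h2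
  subst ho hi
  rfl

instance (w : List DyckStep) (m : ℕ) : Fintype (ShapesOn w m) := Fintype.ofFinite _

/-! ### Factors of a path and pairwise disjoint occurrences -/

/-- A (nonempty) factor of `w`, with its position: the pair `(a, b)`, `a < b`, stands for the
occurrence in `w` of the subword made of the steps number `a, a + 1, …, b - 1` (counted
from `0`). -/
def Factor (w : List DyckStep) : Type :=
  {p : Fin (w.length + 1) × Fin (w.length + 1) // p.1 < p.2}

namespace Factor

variable {w : List DyckStep}

instance : Fintype (Factor w) :=
  inferInstanceAs (Fintype {p : Fin (w.length + 1) × Fin (w.length + 1) // p.1 < p.2})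

/-- Position of the first step of the factor. -/
def first (f : Factor w) : ℕ := f.1.1

/-- Position just after the last step of the factor. -/
def finish (f : Factor w) : ℕ := f.1.2

/-- The factor, as a word. -/
def word (f : Factor w) : List DyckStep := (w.take f.finish).drop f.first

/-- The positions in `w` of the steps of the factor. -/
def positions (f : Factor w) : Finset ℕ := Finset.Ico f.first f.finish

end Factor

/-- The parts `λ₁ ≥ λ₂ ≥ ⋯ ≥ λₖ` of a partition, in decreasing order. -/
def Nat.Partition.partList {h : ℕ} (lam : h.Partition) : List ℕ := lam.parts.sort (· ≥ ·)

/-- `occ` is a family `γ₁, …, γₖ` of pairwise disjoint occurrences of factors of `w`, where `γᵢ`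
is the lower border of some skew Ferrers shape of area `λᵢ`. Such families are unordered, so those
which differ only by a permutation of the factors belonging to equal parts of `λ` are the same;
`ordered` selects the representative where factors belonging to equal parts are listed from left
to right. -/
structure IsPDO {w : List DyckStep} {h : ℕ} (lam : h.Partition)
    (occ : Fin lam.partList.length → Factor w) : Prop where
  disjoint : ∀ i j, i ≠ j → Disjoint (occ i).positions (occ j).positions
  ordered : ∀ i j, i < j → lam.partList[i] = lam.partList[j] → (occ i).first < (occ j).first
  exists_shape : ∀ i, ∃ φ : SkewFerrersShape,
    φ.lowerBorder = (occ i).word ∧ φ.area = lam.partList[i]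

/-- The families of pairwise disjoint occurrences in `w` that are adapted to the partition
`lam`. -/
def PDO (w : List DyckStep) {h : ℕ} (lam : h.Partition) : Type :=
  {occ : Fin lam.partList.length → Factor w // IsPDO lam occ}

open Classical in
instance (w : List DyckStep) {h : ℕ} (lam : h.Partition) : Fintype (PDO w lam) :=
  inferInstanceAs (Fintype {occ : Fin lam.partList.length → Factor w // IsPDO lam occ})

end

noncomputable section

/-! ### Flipping valleys of a path -/

/-! A cover in the Dyck lattice turns a single valley into a peak
(`DyckPath.exists_eq_flip_of_covBy`, `DyckPath.covBy_flip`), so a saturated chain starting at `γ` is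
a sequence of valley flips on the word of `γ` (`saturatedChainCount_dyckPath`). What remains
concerns an arbitrary word `w`, Dyck or not.

Cut `w` at the positions that are never flipped. Flips in different blocks do not interact, so the
flip sequences with given cuts are the shuffles of sequences on the blocks, each of which flips
every inner position of its block; exponential generating functions therefore multiply
(`flipEgf_append`). A block on which nothing happens has length one and contributes 1. Hence the
generating function of `w` is a sum over sets of disjoint factors of products of `properEgf`
(`flipEgf_eq_sum_factorFamilies`).

On one block `v`, a flip removes a corner cell from the region above `v`. The removed cells are
those between `v` and a lower set, and the order of removal is a tableau
(`flipCount_eq_sum_innerSets`). All inner positions are flipped exactly when the removed cells meet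
all inner diagonals. For a nonempty set of removed cells this amounts to forming a skew Ferrers
shape with lower border `v` (`SkewFerrersShape.exists_mem_diagonal`, `exists_skewFerrersShape`), so
`properEgf v` enumerates tableaux (`sum_tableauCount`).

Extracting a coefficient assigns an area to each factor of a family. Sorting the factors by area,
then from left to right, yields a partition with an adapted family (`sum_PDO_eq_coeff`), and the
factorials combine into the multinomial coefficient (`sum_shapes_eq`). -/

/-- The steps number `q` and `q + 1` of `w` form a valley. -/
def IsValley (w : List DyckStep) (q : ℕ) : Prop :=
  w[q]? = some DyckStep.D ∧ w[q + 1]? = some DyckStep.U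

open Classical in
/-- The positions of the valleys of `w`. -/
def valleys (w : List DyckStep) : Finset ℕ := (range w.length).filter (IsValley w)

/-- Turn the valley at position `q` into a peak. -/
def flipAt (w : List DyckStep) (q : ℕ) : List DyckStep :=
  (w.set q DyckStep.U).set (q + 1) DyckStep.D

@[simp] theorem length_flipAt (w : List DyckStep) (q : ℕ) : (flipAt w q).length = w.length := by
  simp [flipAt]

theorem mem_valleys {w : List DyckStep} {q : ℕ} : q ∈ valleys w ↔ IsValley w q := by
  simp only [valleys, mem_filter, mem_range, and_iff_right_iff_imp]
  intro h
  exact (List.getElem?_eq_some_iff.1 h.1).1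

theorem IsValley.lt {w : List DyckStep} {q : ℕ} (h : IsValley w q) : q + 1 < w.length :=
  (List.getElem?_eq_some_iff.1 h.2).1

/-- The number of sequences of `h` successive flips, starting from `w`, that flip every position
of `R` at least once and never flip a position of `A`. -/
def flipCount (A : Finset ℕ) : ℕ → List DyckStep → Finset ℕ → ℕ
  | 0, _, R => if R = ∅ then 1 else 0
  | h + 1, w, R => ∑ q ∈ valleys w \ A, flipCount A h (flipAt w q) (R.erase q)

/-- Sorts the sequences by whether `q` is ever flipped. -/
theorem flipCount_split {q : ℕ} {A : Finset ℕ} (hA : q ∉ A) (h : ℕ) :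
    ∀ (w : List DyckStep) (R : Finset ℕ), q ∉ R →
      flipCount A h w R = flipCount A h w (insert q R) + flipCount (insert q A) h w R := by
  induction h with
  | zero => intro w R _; simp [flipCount]
  | succ h ih =>
    intro w R hR
    simp only [flipCount]
    by_cases hq : q ∈ valleys w
    · have h1 : valleys w \ A = insert q (valleys w \ insert q A) := by
        ext x; simp only [mem_sdiff, mem_insert]
        by_cases hx : x = q
        · subst hx; simp [hq, hA]
        · simp [hx]
      have h2 : q ∉ valleys w \ insert q A := by simp
      rw [h1, sum_insert h2, sum_insert h2, erase_insert hR, erase_eq_of_notMem hR, add_assoc,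
        ← sum_add_distrib]
      congr 1
      refine sum_congr rfl fun x hx => ?_
      have hxq : x ≠ q := fun e => h2 (e ▸ hx)
      rw [erase_insert_of_ne hxq.symm]
      exact ih _ _ fun hm => hR (mem_of_mem_erase hm)
    · have h1 : valleys w \ insert q A = valleys w \ A := by
        ext x; simp only [mem_sdiff, mem_insert]
        by_cases hx : x = q
        · subst hx; simp [hq]
        · simp [hx]
      rw [h1, ← sum_add_distrib]
      refine sum_congr rfl fun x hx => ?_
      have hxq : x ≠ q := fun e => hq (e ▸ (mem_sdiff.1 hx).1)
      rw [erase_insert_of_ne hxq.symm]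
      exact ih _ _ fun hm => hR (mem_of_mem_erase hm)

/-- Sorts the sequences by the first position `k < K` that is never flipped, if there is one. -/
theorem flipCount_eq_sum_first_avoided (h : ℕ) (w : List DyckStep) (K : ℕ) :
    flipCount ∅ h w ∅ =
      ∑ k ∈ range K, flipCount {k} h w (range k) + flipCount ∅ h w (range K) := by
  induction K with
  | zero => simp
  | succ K ih =>
    rw [ih, sum_range_succ, flipCount_split (q := K) (notMem_empty K) h w (range K) (by simp),
      range_add_one, insert_empty_eq]
    ring

/-! ### Generating functions of flip sequences -/

/-- The exponential generating function of `flipCount`. -/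
def flipEgf (A R : Finset ℕ) (w : List DyckStep) : PowerSeries ℚ :=
  PowerSeries.mk fun h => (flipCount A h w R : ℚ) / (h.factorial : ℚ)

/-- Differentiating an exponential generating function strips the first flip of each sequence. -/
theorem derivative_flipEgf (A R : Finset ℕ) (w : List DyckStep) :
    PowerSeries.derivative ℚ (flipEgf A R w) =
      ∑ q ∈ valleys w \ A, flipEgf A (R.erase q) (flipAt w q) := by
  ext h
  rw [PowerSeries.coeff_derivative, map_sum]
  simp only [flipEgf, PowerSeries.coeff_mk, flipCount, Nat.factorial_succ]
  push_cast
  rw [← sum_div]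
  have : (h.factorial : ℚ) ≠ 0 := by exact_mod_cast h.factorial_ne_zero
  have : (h + 1 : ℚ) ≠ 0 := by positivity
  field_simp

theorem flipAt_append_left {u v : List DyckStep} {q : ℕ} (h : q + 1 < u.length) :
    flipAt (u ++ v) q = flipAt u q ++ v := by
  rw [flipAt, flipAt, List.set_append_left _ _ (by omega), List.set_append_left _ _ (by simpa)]

theorem flipAt_append_right (u v : List DyckStep) (q : ℕ) :
    flipAt (u ++ v) (u.length + q) = u ++ flipAt v q := by
  rw [flipAt, flipAt, List.set_append_right _ _ (by omega), List.set_append_right _ _ (by omega),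
    show u.length + q - u.length = q by omega,
    show u.length + q + 1 - u.length = q + 1 by omega]

/-- Position `u.length - 1` is the only one whose two steps straddle the junction. -/
theorem valleys_append {u : List DyckStep} (hu : u ≠ []) (v : List DyckStep) :
    valleys (u ++ v) \ {u.length - 1} =
      (valleys u).disjUnion ((valleys v).map (addLeftEmbedding u.length)) (by
        rw [disjoint_left]
        intro q hq hq'
        obtain ⟨r, _, rfl⟩ := mem_map.1 hq'
        have := (mem_valleys.1 hq).lt
        simp at this
        omega) := by
  have hu' := List.length_pos_iff.2 hu
  ext q
  simp only [mem_sdiff, mem_valleys, mem_singleton, disjUnion_eq_union, mem_union, mem_map,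
    addLeftEmbedding_apply, IsValley]
  constructor
  · rintro ⟨⟨h1, h2⟩, h3⟩
    rcases lt_or_ge (q + 1) u.length with h | h
    · left
      rw [List.getElem?_append_left (by omega)] at h1 h2
      exact ⟨h1, h2⟩
    · right
      rw [List.getElem?_append_right (by omega)] at h1 h2
      refine ⟨q - u.length, ⟨h1, ?_⟩, by omega⟩
      rw [← h2]; congr 1; omega
  · rintro (⟨h1, h2⟩ | ⟨r, ⟨h1, h2⟩, rfl⟩)
    · have := (List.getElem?_eq_some_iff.1 h2).1
      rw [List.getElem?_append_left (by omega), List.getElem?_append_left (by omega)]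
      exact ⟨⟨h1, h2⟩, by omega⟩
    · rw [List.getElem?_append_right (by omega), List.getElem?_append_right (by omega)]
      refine ⟨⟨?_, ?_⟩, by omega⟩
      · rw [← h1]; congr 1; omega
      · rw [← h2]; congr 1; omega

theorem coeff_zero_flipEgf (A R : Finset ℕ) (w : List DyckStep) :
    PowerSeries.coeff 0 (flipEgf A R w) = if R = ∅ then 1 else 0 := by
  simp only [flipEgf, PowerSeries.coeff_mk, flipCount]
  split_ifs <;> simp

/-- Both sides have the same constant term and, by the Leibniz rule, the same derivative recursion:
the first flip takes place either in `u` or in `v`. -/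
theorem flipEgf_append_aux (h : ℕ) : ∀ (u v : List DyckStep) (R : Finset ℕ), u ≠ [] →
    R ⊆ range u.length →
    PowerSeries.coeff h (flipEgf {u.length - 1} R (u ++ v)) =
      PowerSeries.coeff h (flipEgf ∅ R u * flipEgf ∅ ∅ v) := by
  induction h with
  | zero =>
    intro u v R _ _
    simp [PowerSeries.coeff_mul, coeff_zero_flipEgf]
  | succ h ih =>
    intro u v R hu hR
    have hne : (h + 1 : ℚ) ≠ 0 := by positivity
    apply mul_right_cancel₀ hne
    rw [← PowerSeries.coeff_derivative, ← PowerSeries.coeff_derivative, derivative_flipEgf,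
      Derivation.leibniz, derivative_flipEgf, derivative_flipEgf, valleys_append hu, sum_disjUnion,
      sum_map, smul_eq_mul, smul_eq_mul, mul_sum, mul_sum, add_comm, map_add, map_add]
    simp only [map_sum, sdiff_empty, addLeftEmbedding_apply]
    congr 1
    · refine sum_congr rfl fun q _ => ?_
      rw [flipAt_append_right, erase_eq_of_notMem (fun hm => by simpa using hR hm),
        erase_eq_of_notMem (notMem_empty q)]
      exact ih u _ R hu hR
    · refine sum_congr rfl fun q hq => ?_
      have hq' := (mem_valleys.1 hq).lt
      rw [flipAt_append_left hq', mul_comm, ← ih (flipAt u q) v (R.erase q)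
        (by rw [← List.length_pos_iff, length_flipAt]; omega)
        (by rw [length_flipAt]; exact (erase_subset _ _).trans hR), length_flipAt]

theorem flipEgf_append {u : List DyckStep} (v : List DyckStep) {R : Finset ℕ} (hu : u ≠ [])
    (hR : R ⊆ range u.length) :
    flipEgf {u.length - 1} R (u ++ v) = flipEgf ∅ R u * flipEgf ∅ ∅ v := by
  ext h
  exact flipEgf_append_aux h u v R hu hR

/-- The exponential generating function of the flip sequences on `v` that flip every inner
position. -/
def fullEgf (v : List DyckStep) : PowerSeries ℚ := flipEgf ∅ (range (v.length - 1)) v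

theorem flipEgf_nil : flipEgf ∅ ∅ ([] : List DyckStep) = 1 := by
  ext h
  rw [PowerSeries.coeff_one]
  cases h <;> simp [flipEgf, flipCount, valleys]

/-- The first position `k` never flipped detaches a prefix of length `k + 1` whose inner positions
are all flipped. The last summand covers the case where no inner position of `w` is avoided. -/
theorem flipEgf_eq_sum {w : List DyckStep} (hw : w ≠ []) :
    flipEgf ∅ ∅ w =
      ∑ k ∈ range w.length, fullEgf (w.take (k + 1)) * flipEgf ∅ ∅ (w.drop (k + 1)) := by
  obtain ⟨N, hN⟩ : ∃ N, w.length = N + 1 :=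
    ⟨w.length - 1, by have := List.length_pos_iff.2 hw; omega⟩
  have key : ∀ k ∈ range N, fullEgf (w.take (k + 1)) * flipEgf ∅ ∅ (w.drop (k + 1)) =
      flipEgf {k} (range k) w := by
    intro k hk
    have hk := mem_range.1 hk
    have hl : (w.take (k + 1)).length = k + 1 := by simp; omega
    have hu : w.take (k + 1) ≠ [] := by rw [← List.length_pos_iff]; omega
    have := flipEgf_append (w.drop (k + 1)) (R := range k) hu (by
      rw [hl]; exact range_mono (Nat.le_succ k))
    rw [List.take_append_drop, hl, Nat.add_sub_cancel] at this
    rw [this, fullEgf, hl, Nat.add_sub_cancel]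
  rw [hN, sum_range_succ, sum_congr rfl key, ← hN, List.take_length, List.drop_length, flipEgf_nil,
    mul_one, fullEgf, hN, Nat.add_sub_cancel]
  ext h
  rw [map_add, map_sum]
  simp only [flipEgf, PowerSeries.coeff_mk]
  rw [flipCount_eq_sum_first_avoided h w N, ← sum_div, ← add_div]
  push_cast
  rfl

/-! ### Families of disjoint factors -/

namespace Factor

variable {w : List DyckStep}

theorem first_lt_finish (F : Factor w) : F.first < F.finish := F.2

theorem finish_le (F : Factor w) : F.finish ≤ w.length := Nat.lt_succ_iff.1 F.1.2.2

@[ext] theorem ext {F G : Factor w} (h1 : F.first = G.first) (h2 : F.finish = G.finish) :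
    F = G :=
  Subtype.ext (Prod.ext (Fin.ext h1) (Fin.ext h2))

/-- The factor with given ends. -/
def mk (a b : ℕ) (hab : a < b) (hb : b ≤ w.length) : Factor w :=
  ⟨(⟨a, by omega⟩, ⟨b, by omega⟩), hab⟩

theorem first_mem_positions (F : Factor w) : F.first ∈ F.positions :=
  mem_Ico.2 ⟨le_rfl, F.first_lt_finish⟩

theorem disjoint_positions_iff {F G : Factor w} :
    Disjoint F.positions G.positions ↔ F.finish ≤ G.first ∨ G.finish ≤ F.first := by
  have hF := F.first_lt_finish
  have hG := G.first_lt_finish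
  simp only [positions, Finset.disjoint_left, mem_Ico]
  constructor
  · intro h
    by_contra! hc
    rcases le_total F.first G.first with h1 | h1
    · exact h (a := G.first) ⟨h1, hc.1⟩ ⟨le_rfl, hG⟩
    · exact h (a := F.first) ⟨le_rfl, hF⟩ ⟨h1, hc.2⟩
  · rintro h a ⟨h1, h2⟩ ⟨h3, h4⟩
    omega

end Factor

open Classical in
/-- The sets of pairwise disjoint factors of `w` that start at position `i` or later. -/
def factorFamilies (w : List DyckStep) (i : ℕ) : Finset (Finset (Factor w)) :=
  univ.filter fun P => (∀ F ∈ P, i ≤ F.first) ∧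
    (P : Set (Factor w)).PairwiseDisjoint Factor.positions

theorem mem_factorFamilies {w : List DyckStep} {i : ℕ} {P : Finset (Factor w)} :
    P ∈ factorFamilies w i ↔ (∀ F ∈ P, i ≤ F.first) ∧
      (P : Set (Factor w)).PairwiseDisjoint Factor.positions := by
  simp [factorFamilies]

-- A family either has no factor starting at `i`, or has exactly one, and then all its other factors
-- start after that one ends.
open Classical in
theorem sum_factorFamilies_succ {R : Type*} [CommSemiring R] {w : List DyckStep}
    (g : Factor w → R) (i : ℕ) :
    ∑ P ∈ factorFamilies w i, ∏ F ∈ P, g F =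
      ∑ P ∈ factorFamilies w (i + 1), ∏ F ∈ P, g F +
        ∑ F : Factor w with F.first = i,
          g F * ∑ P ∈ factorFamilies w F.finish, ∏ G ∈ P, g G := by
  have hsub : factorFamilies w (i + 1) ⊆ factorFamilies w i := by
    intro P hP
    rw [mem_factorFamilies] at hP ⊢
    exact ⟨fun F hF => (Nat.le_succ i).trans (hP.1 F hF), hP.2⟩
  rw [← sum_sdiff hsub, add_comm]
  congr 1
  simp only [mul_sum]
  rw [sum_sigma']
  symm
  refine sum_bij (fun x _ => insert x.1 x.2) ?_ ?_ ?_ ?_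
  · rintro ⟨F, P⟩ h
    simp only [mem_sigma, mem_filter, mem_univ, true_and, mem_sdiff, mem_factorFamilies] at h ⊢
    obtain ⟨hF, h1, h2⟩ := h
    have hFf := F.first_lt_finish
    refine ⟨⟨?_, ?_⟩, fun hc => ?_⟩
    · intro G hG
      rcases mem_insert.1 hG with rfl | hG
      · exact hF.ge
      · have := h1 G hG
        omega
    · rw [coe_insert]
      exact h2.insert fun G hG _ => Factor.disjoint_positions_iff.2 (Or.inl (h1 G hG))
    · have := hc.1 F (mem_insert_self _ _)
      omega
  · rintro ⟨F, P⟩ h ⟨F', P'⟩ h' heq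
    simp only [mem_sigma, mem_filter, mem_univ, true_and, mem_factorFamilies] at h h' heq
    have hFf := F.first_lt_finish
    have hFf' := F'.first_lt_finish
    have hFP : F ∉ P := fun hm => by have := h.2.1 F hm; omega
    have hFP' : F' ∉ P' := fun hm => by have := h'.2.1 F' hm; omega
    have hFF : F = F' := by
      have := heq ▸ mem_insert_self F P
      rcases mem_insert.1 this with e | e
      · exact e
      · have := h'.2.1 F e
        omega
    subst hFF
    have : P = P' := by rw [← erase_insert hFP, heq, erase_insert hFP']
    rw [this]
  · intro P hP
    simp only [mem_sdiff, mem_factorFamilies, not_and] at hP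
    obtain ⟨⟨h1, h2⟩, h3⟩ := hP
    obtain ⟨F, hF, hFi⟩ : ∃ F ∈ P, F.first = i := by
      by_contra! hc
      exact h3 (fun F hF => lt_of_le_of_ne (h1 F hF) (hc F hF).symm) h2
    refine ⟨⟨F, P.erase F⟩, ?_, insert_erase hF⟩
    simp only [mem_sigma, mem_filter, mem_univ, true_and, mem_factorFamilies]
    refine ⟨hFi, fun G hG => ?_, h2.subset (by simp)⟩
    have hG' := mem_of_mem_erase hG
    rcases Factor.disjoint_positions_iff.1 (h2 hF hG' (ne_of_mem_erase hG).symm) with h | h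
    · exact h
    · have := h1 G hG'
      have := G.first_lt_finish
      omega
  · rintro ⟨F, P⟩ h
    simp only [mem_sigma, mem_filter, mem_univ, true_and, mem_factorFamilies] at h
    have hFf := F.first_lt_finish
    rw [prod_insert fun hm => by have := h.2.1 F hm; omega]

theorem sum_factor_first_eq {R : Type*} [AddCommMonoid R] {w : List DyckStep} {i : ℕ}
    (f : List DyckStep → ℕ → R) :
    ∑ F : Factor w with F.first = i, f F.word F.finish =
      ∑ k ∈ range (w.length - i), f ((w.drop i).take (k + 1)) (i + (k + 1)) := by
  symm
  refine sum_bij (fun k hk => Factor.mk i (i + (k + 1)) (by omega)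
    (by have := mem_range.1 hk; omega)) ?_ ?_ ?_ ?_
  · intro k _
    rw [mem_filter]
    exact ⟨mem_univ _, rfl⟩
  · intro k _ k' _ h
    have : i + (k + 1) = i + (k' + 1) := congrArg Factor.finish h
    omega
  · intro F hF
    rw [mem_filter] at hF
    have h1 := F.first_lt_finish
    have h2 := F.finish_le
    refine ⟨F.finish - i - 1, mem_range.2 (by omega), Factor.ext hF.2.symm ?_⟩
    change i + (F.finish - i - 1 + 1) = F.finish
    omega
  · intro k _
    change _ = f ((w.take (i + (k + 1))).drop i) (i + (k + 1))
    rw [List.drop_take, Nat.add_sub_cancel_left]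

/-! ### From blocks to families of factors -/

/-- `fullEgf` without its constant term. -/
def properEgf (v : List DyckStep) : PowerSeries ℚ :=
  PowerSeries.mk fun m =>
    if m = 0 then 0 else (flipCount ∅ m v (range (v.length - 1)) : ℚ) / (m.factorial : ℚ)

/-- The empty flip sequence flips every inner position only if there is none, that is, if the block
is a single step. -/
theorem fullEgf_eq {v : List DyckStep} (hv : v ≠ []) :
    fullEgf v = properEgf v + if v.length = 1 then 1 else 0 := by
  have hv' := List.length_pos_iff.2 hv
  ext m
  rw [map_add, apply_ite (PowerSeries.coeff m), PowerSeries.coeff_one, map_zero]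
  simp only [fullEgf, properEgf, flipEgf, PowerSeries.coeff_mk]
  rcases m with _ | m
  · simp only [flipCount, range_eq_empty_iff, if_true]
    by_cases h : v.length = 1
    · simp [h]
    · simp [h, show v.length - 1 ≠ 0 by omega]
  · simp

/-- `flipEgf_eq_sum` and `sum_factorFamilies_succ` are the same recursion on suffixes; `j` bounds
the length of the suffix for the induction. -/
theorem flipEgf_drop_eq_sum {w : List DyckStep} (j : ℕ) : ∀ i, w.length - i ≤ j → i ≤ w.length →
    flipEgf ∅ ∅ (w.drop i) = ∑ P ∈ factorFamilies w i, ∏ F ∈ P, properEgf F.word := by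
  classical
  have hend : flipEgf ∅ ∅ (w.drop w.length) =
      ∑ P ∈ factorFamilies w w.length, ∏ F ∈ P, properEgf F.word := by
    have : factorFamilies w w.length = {∅} := by
      ext P
      rw [mem_factorFamilies, mem_singleton]
      constructor
      · rintro ⟨h, -⟩
        refine eq_empty_of_forall_notMem fun F hF => ?_
        have := h F hF
        have := F.first_lt_finish
        have := F.finish_le
        omega
      · rintro rfl
        simp
    rw [this, List.drop_length, flipEgf_nil]
    simp
  induction j with
  | zero =>
    intro i h1 h2
    obtain rfl : i = w.length := by omega
    exact hend
  | succ j ih =>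
    intro i h1 h2
    rcases h2.eq_or_lt with rfl | h2
    · exact hend
    have hne : w.drop i ≠ [] := by rw [← List.length_pos_iff, List.length_drop]; omega
    rw [sum_factorFamilies_succ, flipEgf_eq_sum hne, List.length_drop,
      sum_factor_first_eq (fun v b => properEgf v *
        ∑ P ∈ factorFamilies w b, ∏ G ∈ P, properEgf G.word), ← ih (i + 1) (by omega) (by omega)]
    -- The constant term 1 of a one-step block (`k = 0`) accounts for the families in which no
    -- factor starts at `i`.
    have hterm : ∀ k ∈ range (w.length - i),
        fullEgf ((w.drop i).take (k + 1)) * flipEgf ∅ ∅ ((w.drop i).drop (k + 1)) =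
          (if k = 0 then flipEgf ∅ ∅ (w.drop (i + 1)) else 0) +
          properEgf ((w.drop i).take (k + 1)) *
            ∑ P ∈ factorFamilies w (i + (k + 1)), ∏ G ∈ P, properEgf G.word := by
      intro k hk
      have hk := mem_range.1 hk
      have hl : ((w.drop i).take (k + 1)).length = k + 1 := by simp; omega
      rw [fullEgf_eq (by rw [← List.length_pos_iff]; omega), hl, List.drop_drop,
        ih (i + (k + 1)) (by omega) (by omega), add_mul, add_comm]
      congr 1
      by_cases hk0 : k = 0
      · subst hk0
        simp [ih (i + 1) (by omega) (by omega)]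
      · simp [hk0]
    rw [sum_congr rfl hterm, sum_add_distrib, sum_ite_eq' (range (w.length - i)) 0,
      if_pos (mem_range.2 (by omega))]

theorem flipEgf_eq_sum_factorFamilies (w : List DyckStep) :
    flipEgf ∅ ∅ w = ∑ P ∈ factorFamilies w 0, ∏ F ∈ P, properEgf F.word :=
  flipEgf_drop_eq_sum w.length 0 (by omega) (Nat.zero_le _)

/-! ### Families of factors indexed by the parts of a partition -/

/-- The order in which the factors of a family are listed: by decreasing value of `l`, then from
left to right. -/
def Factor.sortKey {w : List DyckStep} (l : Factor w → ℕ) (F : Factor w) : ℕᵒᵈ ×ₗ (ℕ ×ₗ ℕ) :=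
  toLex (OrderDual.toDual (l F), toLex (F.first, F.finish))

theorem Factor.sortKey_injective {w : List DyckStep} (l : Factor w → ℕ) :
    Function.Injective (Factor.sortKey l) := by
  intro F G h
  have h2 := congrArg (fun x => ofLex (ofLex x).2) h
  exact Factor.ext (congrArg Prod.fst h2) (congrArg Prod.snd h2)

theorem Factor.sortKey_lt_iff {w : List DyckStep} {l : Factor w → ℕ} {F G : Factor w} :
    F.sortKey l < G.sortKey l ↔ l G < l F ∨ l F = l G ∧
      (F.first < G.first ∨ F.first = G.first ∧ F.finish < G.finish) := by
  simp [Factor.sortKey, Prod.Lex.toLex_lt_toLex]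

namespace Nat.Partition

variable {h : ℕ} (lam : h.Partition)

theorem coe_partList : (lam.partList : Multiset ℕ) = lam.parts := Multiset.sort_eq _ _

theorem pairwise_partList : lam.partList.Pairwise (· ≥ ·) := Multiset.pairwise_sort _ _

theorem sum_partList : ∑ i : Fin lam.partList.length, lam.partList[i] = h := by
  have h1 : lam.partList.sum = h := by
    rw [← Multiset.sum_coe, coe_partList, lam.parts_sum]
  rw [← Fin.sum_univ_getElem] at h1
  exact h1

theorem map_partList : Finset.univ.val.map (fun i : Fin lam.partList.length => lam.partList[i]) =
    lam.parts := by
  rw [← coe_partList, Fin.univ_val_map]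
  congr 1
  exact List.ofFn_getElem

end Nat.Partition

theorem IsPDO.injective {w : List DyckStep} {h : ℕ} {lam : h.Partition}
    {occ : Fin lam.partList.length → Factor w} (hocc : IsPDO lam occ) :
    Function.Injective occ := by
  intro i j hij
  by_contra hne
  have := hocc.disjoint i j hne
  rw [hij] at this
  exact Finset.disjoint_left.1 this (occ j).first_mem_positions (occ j).first_mem_positions

theorem IsPDO.strictMono_sortKey {w : List DyckStep} {h : ℕ} {lam : h.Partition}
    {occ : Fin lam.partList.length → Factor w} (hocc : IsPDO lam occ) {l : Factor w → ℕ}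
    (hl : ∀ i, l (occ i) = lam.partList[i]) :
    StrictMono fun i => (occ i).sortKey l := by
  intro i j hij
  rw [Factor.sortKey_lt_iff, hl, hl]
  have h1 : lam.partList[i] ≥ lam.partList[j] :=
    List.pairwise_iff_getElem.1 lam.pairwise_partList i j i.2 j.2 hij
  rcases h1.eq_or_lt with h2 | h2
  · exact Or.inr ⟨h2.symm, Or.inl (hocc.ordered i j hij h2.symm)⟩
  · exact Or.inl h2

/-- The set of factors with their labels determines everything: the parts are the multiset of
labels, and the listing is the unique increasing one for `Factor.sortKey`. -/
theorem PDO.sigma_ext {w : List DyckStep} {h : ℕ} {x y : Σ lam : h.Partition, PDO w lam}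
    {l : Factor w → ℕ} (hx : ∀ i, l (x.2.1 i) = x.1.partList[i])
    (hy : ∀ i, l (y.2.1 i) = y.1.partList[i])
    (hr : Set.range x.2.1 = Set.range y.2.1) : x = y := by
  classical
  obtain ⟨lam, occ, hocc⟩ := x
  obtain ⟨mu, occ', hocc'⟩ := y
  simp only at hx hy hr
  have key : ∀ (nu : h.Partition) (o : Fin nu.partList.length → Factor w), IsPDO nu o →
      (∀ i, l (o i) = nu.partList[i]) → nu.parts = (univ.image o).val.map l := by
    intro nu o ho hlo
    rw [← nu.map_partList, image_val_of_injOn ho.injective.injOn, Multiset.map_map]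
    exact Multiset.map_congr rfl fun i _ => (hlo i).symm
  have hlm : lam = mu := by
    refine Nat.Partition.ext ?_
    rw [key lam occ hocc hx, key mu occ' hocc' hy]
    congr 2
    rw [← coe_inj]
    simpa using hr
  subst hlm
  have : occ = occ' := by
    have h1 := ((hocc.strictMono_sortKey hx).range_inj (hocc'.strictMono_sortKey hy)).1 (by
      rw [show (fun i => (occ i).sortKey l) = Factor.sortKey l ∘ occ from rfl,
        show (fun i => (occ' i).sortKey l) = Factor.sortKey l ∘ occ' from rfl,
        Set.range_comp, Set.range_comp, hr])
    funext i
    exact Factor.sortKey_injective l (congrFun h1 i)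
  subst this
  rfl

/-- Sorting `P` by `Factor.sortKey` gives the listing; the partition is the multiset of labels. -/
theorem PDO.exists_of_family {w : List DyckStep} {h : ℕ} {P : Finset (Factor w)}
    (hP : (P : Set (Factor w)).PairwiseDisjoint Factor.positions) {l : Factor w → ℕ}
    (hpos : ∀ F ∈ P, 0 < l F) (hsum : ∑ F ∈ P, l F = h)
    (hshape : ∀ F ∈ P, ∃ φ : SkewFerrersShape, φ.lowerBorder = F.word ∧ φ.area = l F) :
    ∃ x : Σ lam : h.Partition, PDO w lam,
      (∀ i, l (x.2.1 i) = x.1.partList[i]) ∧ Set.range x.2.1 = P := by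
  let _ : LinearOrder (Factor w) :=
    LinearOrder.lift' (Factor.sortKey l) (Factor.sortKey_injective l)
  let lam : h.Partition :=
    ⟨P.val.map l, fun {i} hi => by
      obtain ⟨F, hF, rfl⟩ := Multiset.mem_map.1 hi
      exact hpos F hF, hsum⟩
  let L : List (Factor w) := P.sort (· ≤ ·)
  have hmem : ∀ F, F ∈ L ↔ F ∈ P := fun F => Finset.mem_sort _
  have hlt : L.Pairwise fun F G => F.sortKey l < G.sortKey l :=
    (Finset.sortedLT_sort P).pairwise
  have hL : lam.partList = L.map l := by
    refine List.Perm.eq_of_pairwise' (r := (· ≥ ·)) lam.pairwise_partList ?_ ?_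
    · rw [List.pairwise_map]
      refine hlt.imp fun {F G} hFG => ?_
      rcases Factor.sortKey_lt_iff.1 hFG with h | h
      · exact h.le
      · exact h.1.ge
    · rw [← Multiset.coe_eq_coe, lam.coe_partList, ← Multiset.map_coe, Finset.sort_eq]
  have hlen : lam.partList.length = L.length := by rw [hL, List.length_map]
  let occ : Fin lam.partList.length → Factor w := fun i => L[i.1]'(hlen ▸ i.2)
  have hocc : ∀ i, l (occ i) = lam.partList[i] := by
    intro i
    have : lam.partList[i.1] = (L.map l)[i.1]'(by rw [List.length_map]; exact hlen ▸ i.2) :=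
      List.getElem_of_eq hL _
    rw [Fin.getElem_fin, this, List.getElem_map]
  have hoccP : ∀ i, occ i ∈ P := fun i => (hmem _).1 (List.getElem_mem _)
  have hocclt : ∀ i j, i < j → (occ i).sortKey l < (occ j).sortKey l := fun i j hij =>
    List.pairwise_iff_getElem.1 hlt i j _ _ hij
  have hne : ∀ i j, i ≠ j → occ i ≠ occ j := by
    intro i j hij heq
    rcases lt_or_gt_of_ne hij with h | h
    · exact (hocclt i j h).ne (by rw [heq])
    · exact (hocclt j i h).ne (by rw [heq])
  have hdisj : ∀ i j, i ≠ j → Disjoint (occ i).positions (occ j).positions := fun i j hij =>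
    hP (hoccP i) (hoccP j) (hne i j hij)
  refine ⟨⟨lam, occ, hdisj, ?_, ?_⟩, hocc, ?_⟩
  · intro i j hij hv
    have h1 := Factor.sortKey_lt_iff.1 (hocclt i j hij)
    rw [hocc, hocc] at h1
    rcases h1 with h1 | ⟨-, h1 | ⟨h1, -⟩⟩
    · omega
    · exact h1
    · have h2 := (occ i).first_mem_positions
      exact absurd (h1 ▸ (occ j).first_mem_positions)
        (Finset.disjoint_left.1 (hdisj i j hij.ne) h2)
  · intro i
    rw [← hocc]
    exact hshape _ (hoccP i)
  · ext F
    simp only [Set.mem_range, mem_coe]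
    constructor
    · rintro ⟨i, rfl⟩
      exact hoccP i
    · intro hF
      obtain ⟨k, hk, rfl⟩ := List.getElem_of_mem ((hmem F).2 hF)
      exact ⟨⟨k, hlen ▸ hk⟩, rfl⟩

/-- Expanding the coefficient gives a sum over sets of disjoint factors labelled by numbers of sum
`h`. The labelled sets with nonzero weight all come from some partition and adapted family. -/
theorem sum_PDO_eq_coeff {w : List DyckStep} (h : ℕ) (a : Factor w → ℕ → ℚ)
    (ha0 : ∀ F, a F 0 = 0)
    (ha : ∀ F m, a F m ≠ 0 → ∃ φ : SkewFerrersShape, φ.lowerBorder = F.word ∧ φ.area = m) :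
    ∑ lam : h.Partition, ∑ occ : PDO w lam, ∏ i, a (occ.1 i) lam.partList[i] =
      PowerSeries.coeff h
        (∑ P ∈ factorFamilies w 0, ∏ F ∈ P, PowerSeries.mk (a F)) := by
  classical
  simp only [map_sum, PowerSeries.coeff_prod, PowerSeries.coeff_mk]
  rw [← Fintype.sum_sigma', sum_sigma']
  let lv : (Σ lam : h.Partition, PDO w lam) → Factor w →₀ ℕ := fun x =>
    Finsupp.mapDomain x.2.1 (Finsupp.equivFunOnFinite.symm fun i => x.1.partList[i])
  have hlv : ∀ x i, lv x (x.2.1 i) = x.1.partList[i] := fun x i =>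
    Finsupp.mapDomain_apply x.2.2.injective _ _
  have hlv' : ∀ x, ∀ F ∉ Set.range x.2.1, lv x F = 0 := fun x F hF =>
    Finsupp.mapDomain_of_notMem_range _ _ hF
  refine sum_of_injOn (fun x => ⟨univ.image x.2.1, lv x⟩) ?_ ?_ ?_ ?_
  · intro x _ y _ hxy
    simp only [Sigma.mk.injEq, heq_eq_eq] at hxy
    refine PDO.sigma_ext (hlv x) (fun i => hxy.2 ▸ hlv y i) ?_
    have := congrArg (fun s : Finset (Factor w) => (s : Set (Factor w))) hxy.1
    simpa using this
  · intro x _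
    simp only [coe_sigma, Set.mem_sigma_iff, mem_coe, mem_factorFamilies, mem_finsuppAntidiag]
    refine ⟨⟨fun _ _ => Nat.zero_le _, ?_⟩, ?_, ?_⟩
    · intro F hF G hG hFG
      simp only [coe_image, coe_univ, Set.image_univ, Set.mem_range] at hF hG
      obtain ⟨i, rfl⟩ := hF
      obtain ⟨j, rfl⟩ := hG
      exact x.2.2.disjoint i j fun e => hFG (e ▸ rfl)
    · rw [sum_image x.2.2.injective.injOn, sum_congr rfl fun i _ => hlv x i]
      exact x.1.sum_partList
    · intro F hF
      by_contra hc
      refine Finsupp.mem_support_iff.1 hF (hlv' x F ?_)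
      simpa using hc
  -- A nonzero weight forces positive labels (`ha0`) and the existence of shapes (`ha`), so the
  -- labelled set has a preimage.
  · rintro ⟨P, l⟩ hPl hnot
    by_contra hne
    simp only [mem_sigma, mem_factorFamilies, mem_finsuppAntidiag] at hPl
    have hF : ∀ F ∈ P, a F (l F) ≠ 0 := prod_ne_zero_iff.1 hne
    obtain ⟨x, hx1, hx2⟩ := PDO.exists_of_family hPl.1.2 (l := l)
      (fun F hFP => Nat.pos_of_ne_zero fun h0 => hF F hFP (by rw [h0, ha0])) hPl.2.1
      (fun F hFP => ha F _ (hF F hFP))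
    refine hnot ⟨x, by simp, ?_⟩
    have h1 : univ.image x.2.1 = P := by
      rw [← coe_inj, ← hx2]; simp
    have h2 : lv x = l := by
      ext F
      by_cases hFr : F ∈ Set.range x.2.1
      · obtain ⟨i, rfl⟩ := hFr
        rw [hlv, hx1]
      · rw [hlv' x F hFr]
        symm
        rw [← Finsupp.notMem_support_iff]
        intro hm
        exact hFr (hx2 ▸ mem_coe.2 (hPl.2.2 hm))
    simp only [h1, h2]
  · intro x _
    rw [prod_image x.2.2.injective.injOn]
    exact prod_congr rfl fun i _ => by rw [hlv]

/-! ### Saturated chains with a given bottom -/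

/-- The number of saturated chains of length `h` that start at `x`. -/
def saturatedChainCountFrom {P : Type*} [PartialOrder P] (h : ℕ) (x : P) : ℕ :=
  Nat.card {c : Fin (h + 1) → P // (∀ i : Fin h, c i.castSucc ⋖ c i.succ) ∧ c 0 = x}

theorem saturatedChainCount_eq_sum (P : Type*) [PartialOrder P] [Fintype P] (h : ℕ) :
    saturatedChainCount P h = ∑ x : P, saturatedChainCountFrom h x := by
  classical
  have e : {c : Fin (h + 1) → P // ∀ i : Fin h, c i.castSucc ⋖ c i.succ} ≃
      Σ x : P, {c : Fin (h + 1) → P // (∀ i : Fin h, c i.castSucc ⋖ c i.succ) ∧ c 0 = x} :=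
    { toFun := fun c => ⟨c.1 0, c.1, c.2, rfl⟩
      invFun := fun c => ⟨c.2.1, c.2.2.1⟩
      left_inv := fun c => rfl
      right_inv := by rintro ⟨x, c, hc, rfl⟩; rfl }
  rw [saturatedChainCount, Nat.card_congr e, Nat.card_sigma]
  rfl

theorem saturatedChainCountFrom_zero {P : Type*} [PartialOrder P] (x : P) :
    saturatedChainCountFrom 0 x = 1 := by
  rw [saturatedChainCountFrom, Nat.card_eq_one_iff_unique]
  refine ⟨⟨fun c d => Subtype.ext (funext fun i => ?_)⟩, ⟨fun _ => x, fun i => i.elim0, rfl⟩⟩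
  obtain rfl : i = 0 := Subsingleton.elim (α := Fin 1) i 0
  rw [c.2.2, d.2.2]

open Classical in
theorem saturatedChainCountFrom_succ {P : Type*} [PartialOrder P] [Fintype P] (h : ℕ) (x : P) :
    saturatedChainCountFrom (h + 1) x = ∑ y : P with x ⋖ y, saturatedChainCountFrom h y := by
  have e : {c : Fin (h + 2) → P // (∀ i : Fin (h + 1), c i.castSucc ⋖ c i.succ) ∧ c 0 = x} ≃
      Σ y : {y : P // x ⋖ y},
        {c : Fin (h + 1) → P // (∀ i : Fin h, c i.castSucc ⋖ c i.succ) ∧ c 0 = y} :=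
    { toFun := fun c => ⟨⟨c.1 1, by
          have := c.2.1 0
          rw [Fin.castSucc_zero, c.2.2] at this
          exact this⟩, fun i => c.1 i.succ, fun i => c.2.1 i.succ, rfl⟩
      invFun := fun d => ⟨Fin.cons x d.2.1, by
        refine ⟨fun i => ?_, rfl⟩
        refine Fin.cases ?_ (fun i => ?_) i
        · have := d.1.2
          rw [← d.2.2.2] at this
          simpa using this
        · rw [← Fin.succ_castSucc, Fin.cons_succ, Fin.cons_succ]
          exact d.2.2.1 i⟩
      left_inv := by
        rintro ⟨c, hc, rfl⟩
        exact Subtype.ext (Fin.cons_self_tail c)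
      right_inv := by
        rintro ⟨⟨y, hy⟩, ⟨c, hc, hcy⟩⟩
        obtain rfl : c 0 = y := hcy
        rfl }
  rw [saturatedChainCountFrom, Nat.card_congr e, Nat.card_sigma]
  exact (sum_subtype (univ.filter fun y => x ⋖ y) (by simp)
    (fun y => saturatedChainCountFrom h y)).symm

/-! ### Heights and flips -/

theorem count_U_add_count_D (w : List DyckStep) :
    w.count DyckStep.U + w.count DyckStep.D = w.length := by
  induction w with
  | nil => rfl
  | cons s w ih => cases s <;> simp <;> omega

theorem count_take_succ (w : List DyckStep) (s : DyckStep) (i : ℕ) :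
    (w.take (i + 1)).count s = (w.take i).count s + if w[i]? = some s then 1 else 0 := by
  rw [List.take_add_one, List.count_append]
  congr 1
  rcases w[i]? with _ | t
  · simp
  · cases s <;> cases t <;> simp

theorem getElem?_flipAt {w : List DyckStep} {q : ℕ} (hq : IsValley w q) (i : ℕ) :
    (flipAt w q)[i]? = if i = q then some DyckStep.U else if i = q + 1 then some DyckStep.D
      else w[i]? := by
  have := hq.lt
  rw [flipAt, List.getElem?_set, List.getElem?_set]
  simp only [List.length_set]
  split_ifs <;> first | rfl | omega

/-- A flip swaps two adjacent steps, and only the prefix of length `q + 1` separates them. -/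
theorem count_D_take_flipAt {w : List DyckStep} {q : ℕ} (hq : IsValley w q) (i : ℕ) :
    (w.take i).count DyckStep.D =
      ((flipAt w q).take i).count DyckStep.D + if i = q + 1 then 1 else 0 := by
  induction i with
  | zero => simp
  | succ i ih =>
    rw [count_take_succ, count_take_succ, ih, getElem?_flipAt hq]
    by_cases h1 : i = q
    · subst h1
      simp [hq.1]
    · by_cases h2 : i = q + 1
      · subst h2
        simp [hq.2]
      · simp [h1, h2]

theorem pathHeight_eq (w : List DyckStep) (i : ℕ) :
    pathHeight w i = (min i w.length : ℕ) - 2 * ((w.take i).count DyckStep.D : ℤ) := by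
  have := count_U_add_count_D (w.take i)
  rw [List.length_take] at this
  rw [pathHeight, ← this]
  push_cast
  ring

theorem pathHeight_flipAt {w : List DyckStep} {q : ℕ} (hq : IsValley w q) (i : ℕ) :
    pathHeight (flipAt w q) i = pathHeight w i + if i = q + 1 then 2 else 0 := by
  rw [pathHeight_eq, pathHeight_eq, count_D_take_flipAt hq, length_flipAt]
  split_ifs <;> push_cast <;> ring

theorem flipAt_injOn {w : List DyckStep} {q r : ℕ} (hq : IsValley w q) (hr : IsValley w r)
    (h : flipAt w q = flipAt w r) : q = r := by
  by_contra hne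
  have h1 := pathHeight_flipAt hq (q + 1)
  have h2 := pathHeight_flipAt hr (q + 1)
  rw [h] at h1
  rw [if_pos rfl] at h1
  rw [if_neg (by omega)] at h2
  omega

theorem pathHeight_succ (w : List DyckStep) (i : ℕ) :
    pathHeight w (i + 1) = pathHeight w i + (if w[i]? = some DyckStep.U then 1 else 0) -
      (if w[i]? = some DyckStep.D then 1 else 0) := by
  rw [pathHeight, pathHeight, count_take_succ, count_take_succ]
  push_cast
  ring

namespace DyckPath

variable {n : ℕ}

theorem le_iff {γ γ' : DyckPath n} :
    γ ≤ γ' ↔ ∀ i, pathHeight γ.steps i ≤ pathHeight γ'.steps i := Iff.rfl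

theorem pathHeight_nonneg (γ : DyckPath n) (i : ℕ) : 0 ≤ pathHeight γ.steps i := by
  have := γ.1.count_D_le_count_U i
  rw [pathHeight]
  have : ((γ.steps.take i).count DyckStep.D : ℤ) ≤ (γ.steps.take i).count DyckStep.U := by
    exact_mod_cast this
  omega

theorem pathHeight_of_le (γ : DyckPath n) {i : ℕ} (hi : 2 * n ≤ i) :
    pathHeight γ.steps i = 0 := by
  rw [pathHeight, List.take_of_length_le (by rw [length_steps]; exact hi)]
  have : γ.steps.count DyckStep.U = γ.steps.count DyckStep.D := γ.1.count_U_eq_count_D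
  omega

/-- Turning a valley of a Dyck path into a peak. -/
def flip (γ : DyckPath n) (q : ℕ) (hq : IsValley γ.steps q) : DyckPath n :=
  have key : ∀ i, 0 ≤ pathHeight (flipAt γ.steps q) i := fun i => by
    rw [pathHeight_flipAt hq]
    have := γ.pathHeight_nonneg i
    split_ifs <;> omega
  have key' : (flipAt γ.steps q).count DyckStep.U = (flipAt γ.steps q).count DyckStep.D := by
    have h1 := pathHeight_flipAt hq (2 * n)
    have h2 := hq.lt
    rw [length_steps] at h2
    rw [γ.pathHeight_of_le le_rfl, if_neg (by omega), pathHeight,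
      List.take_of_length_le (by rw [length_flipAt, length_steps])] at h1
    omega
  ⟨⟨flipAt γ.steps q, key', fun i => by
      have := key i
      rw [pathHeight] at this
      omega⟩, by
    have h1 := count_U_add_count_D (flipAt γ.steps q)
    rw [length_flipAt, length_steps] at h1
    change (flipAt γ.steps q).count DyckStep.U = n
    omega⟩

theorem steps_flip (γ : DyckPath n) (q : ℕ) (hq : IsValley γ.steps q) :
    (γ.flip q hq).steps = flipAt γ.steps q := rfl

theorem even_pathHeight_sub (γ γ' : DyckPath n) (i : ℕ) :
    (2 : ℤ) ∣ pathHeight γ'.steps i - pathHeight γ.steps i := by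
  rw [pathHeight_eq, pathHeight_eq, length_steps, length_steps]
  omega

/-- Among the points where `γ` is strictly below `γ'`, one of least height on `γ` is the bottom of a
valley. Heights at the same abscissa have the same parity, so the gap there is at least 2 and leaves
room for the flip. -/
theorem exists_flip_le {γ γ' : DyckPath n} (h : γ < γ') :
    ∃ q, ∃ hq : IsValley γ.steps q, γ.flip q hq ≤ γ' := by
  have hle := le_iff.1 h.le
  have hex : ∃ i, pathHeight γ.steps i < pathHeight γ'.steps i := by
    by_contra! hc
    exact h.not_ge hc
  have hsupp : ∀ i, pathHeight γ.steps i < pathHeight γ'.steps i → i < 2 * n ∧ i ≠ 0 := by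
    intro i hi
    refine ⟨?_, ?_⟩
    · by_contra! hc
      rw [γ.pathHeight_of_le hc, γ'.pathHeight_of_le hc] at hi
      omega
    · rintro rfl
      simp [pathHeight] at hi
  let S := (range (2 * n)).filter fun i => pathHeight γ.steps i < pathHeight γ'.steps i
  have hS : S.Nonempty := by
    obtain ⟨i, hi⟩ := hex
    exact ⟨i, mem_filter.2 ⟨mem_range.2 (hsupp i hi).1, hi⟩⟩
  obtain ⟨p, hp, hmin⟩ := exists_min_image S (pathHeight γ.steps) hS
  have hp' := (mem_filter.1 hp).2
  obtain ⟨hp1, hp0⟩ := hsupp p hp'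
  obtain ⟨q, rfl⟩ := Nat.exists_eq_succ_of_ne_zero hp0
  rw [Nat.succ_eq_add_one] at *
  have hlen := γ.length_steps
  have hlen' := γ'.length_steps
  have hmin' : ∀ i, pathHeight γ.steps i < pathHeight γ'.steps i →
      pathHeight γ.steps (q + 1) ≤ pathHeight γ.steps i := fun i hi =>
    hmin i (mem_filter.2 ⟨mem_range.2 (hsupp i hi).1, hi⟩)
  have hpar := even_pathHeight_sub γ γ'
  have a1 := pathHeight_succ γ.steps q
  have a2 := pathHeight_succ γ.steps (q + 1)
  have b1 := pathHeight_succ γ'.steps q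
  have b2 := pathHeight_succ γ'.steps (q + 1)
  have c1 := hmin' q
  have c2 := hmin' (q + 1 + 1)
  have d0 := hpar (q + 1)
  have hq : IsValley γ.steps q := by
    constructor
    · rcases hg : γ.steps[q]? with _ | _ | _
      · rw [List.getElem?_eq_none_iff] at hg; omega
      -- If an up step led to the chosen point, the preceding point would be lower on `γ` and still
      -- strictly below `γ'`, against minimality.
      · exfalso
        have : pathHeight γ'.steps (q + 1) - 1 ≤ pathHeight γ'.steps q := by
          rw [b1]; split_ifs <;> omega
        simp [hg] at a1
        omega
      · rfl
    · rcases hg : γ.steps[q + 1]? with _ | _ | _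
      · rw [List.getElem?_eq_none_iff] at hg; omega
      · rfl
      · exfalso
        have : pathHeight γ'.steps (q + 1) - 1 ≤ pathHeight γ'.steps (q + 1 + 1) := by
          rw [b2]; split_ifs <;> omega
        simp [hg] at a2
        omega
  refine ⟨q, hq, le_iff.2 fun i => ?_⟩
  rw [steps_flip, pathHeight_flipAt hq]
  have := hpar i
  have := hle i
  split_ifs with hi
  · subst hi; omega
  · omega

theorem lt_flip (γ : DyckPath n) (q : ℕ) (hq : IsValley γ.steps q) : γ < γ.flip q hq := by
  have hh := fun i => pathHeight_flipAt hq i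
  refine lt_of_le_of_ne (le_iff.2 fun i => ?_) fun he => ?_
  · rw [steps_flip, hh]
    split_ifs <;> omega
  · have h1 := hh (q + 1)
    rw [← steps_flip γ q hq, ← he, if_pos rfl] at h1
    omega

theorem covBy_flip (γ : DyckPath n) (q : ℕ) (hq : IsValley γ.steps q) : γ ⋖ γ.flip q hq := by
  refine ⟨γ.lt_flip q hq, fun δ h1 h2 => ?_⟩
  obtain ⟨r, hr, hrle⟩ := exists_flip_le h1
  have hle := le_iff.1 (hrle.trans h2.le)
  have h3 := hle (r + 1)
  rw [steps_flip, steps_flip, pathHeight_flipAt hq, pathHeight_flipAt hr, if_pos rfl] at h3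
  -- Flipping at `q` raises `γ` at the single abscissa `q + 1`, so a flip of `γ` lying below it must
  -- be the same flip.
  have hrq : r = q := by
    by_contra hne
    rw [if_neg (by omega)] at h3
    omega
  subst hrq
  exact h2.not_ge hrle

theorem exists_eq_flip_of_covBy {γ γ' : DyckPath n} (h : γ ⋖ γ') :
    ∃ q, ∃ hq : IsValley γ.steps q, γ.flip q hq = γ' := by
  obtain ⟨q, hq, hle⟩ := exists_flip_le h.lt
  exact ⟨q, hq, (h.eq_or_eq (γ.lt_flip q hq).le hle).resolve_left (γ.lt_flip q hq).ne'⟩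

theorem saturatedChainCountFrom_eq (h : ℕ) :
    ∀ γ : DyckPath n, saturatedChainCountFrom h γ = flipCount ∅ h γ.steps ∅ := by
  classical
  induction h with
  | zero => intro γ; rw [saturatedChainCountFrom_zero]; rfl
  | succ h ih =>
    intro γ
    rw [saturatedChainCountFrom_succ]
    symm
    simp only [flipCount, sdiff_empty]
    refine sum_bij (fun q hq => γ.flip q (mem_valleys.1 hq)) ?_ ?_ ?_ ?_
    · intro q hq
      exact mem_filter.2 ⟨mem_univ _, γ.covBy_flip q _⟩
    · intro q hq r hr he
      exact flipAt_injOn (mem_valleys.1 hq) (mem_valleys.1 hr) (congrArg steps he)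
    · intro γ' hγ'
      obtain ⟨q, hq, he⟩ := exists_eq_flip_of_covBy (mem_filter.1 hγ').2
      exact ⟨q, mem_valleys.2 hq, he⟩
    · intro q hq
      rw [ih, steps_flip, erase_eq_of_notMem (notMem_empty q)]

end DyckPath

theorem saturatedChainCount_dyckPath (n h : ℕ) :
    saturatedChainCount (DyckPath n) h = ∑ γ : DyckPath n, flipCount ∅ h γ.steps ∅ := by
  rw [saturatedChainCount_eq_sum]
  exact sum_congr rfl fun γ _ => γ.saturatedChainCountFrom_eq h

/-! ### Fillings of finite sets of cells -/

/-- `T` is a filling of the cells of `S` by the numbers `1, …, #S`, decreasing along rows and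
columns, extended by `0` outside `S`. -/
structure IsFilling (S : Finset (ℕ × ℕ)) (T : ℕ × ℕ → ℕ) : Prop where
  eq_zero : ∀ c ∉ S, T c = 0
  injOn : Set.InjOn T S
  image_eq : T '' S = Set.Icc 1 #S
  row_decreasing : ∀ c ∈ S, ∀ d ∈ S, c.1 = d.1 → c.2 < d.2 → T d < T c
  col_decreasing : ∀ c ∈ S, ∀ d ∈ S, c.2 = d.2 → c.1 < d.1 → T d < T c

/-- The number of fillings of `S`. -/
def fillingCount (S : Finset (ℕ × ℕ)) : ℕ := Nat.card {T : ℕ × ℕ → ℕ // IsFilling S T}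

theorem IsFilling.mem_Icc {S : Finset (ℕ × ℕ)} {T : ℕ × ℕ → ℕ} (hT : IsFilling S T) {c : ℕ × ℕ}
    (hc : c ∈ S) : 1 ≤ T c ∧ T c ≤ #S := by
  have : T c ∈ Set.Icc 1 #S := hT.image_eq ▸ Set.mem_image_of_mem T hc
  exact this

instance finite_isFilling (S : Finset (ℕ × ℕ)) : Finite {T : ℕ × ℕ → ℕ // IsFilling S T} := by
  refine Finite.of_injective
    (fun T => fun c : S => (⟨T.1 c, Nat.lt_succ_iff.2 (T.2.mem_Icc c.2).2⟩ : Fin (#S + 1))) ?_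
  intro T T' h
  refine Subtype.ext (funext fun c => ?_)
  by_cases hc : c ∈ S
  · exact congrArg Fin.val (congrFun h ⟨c, hc⟩)
  · rw [T.2.eq_zero c hc, T'.2.eq_zero c hc]

theorem fillingCount_empty : fillingCount ∅ = 1 := by
  rw [fillingCount, Nat.card_eq_one_iff_unique]
  refine ⟨⟨fun T T' => Subtype.ext (funext fun c => ?_)⟩, ⟨fun _ => 0, ?_⟩⟩
  · rw [T.2.eq_zero c (notMem_empty c), T'.2.eq_zero c (notMem_empty c)]
  · constructor <;> simp

theorem SkewFerrersShape.tableauCount_eq (φ : SkewFerrersShape) :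
    φ.tableauCount = fillingCount φ.cells := by
  refine Nat.card_congr
    { toFun := fun T => ⟨fun c => if h : c ∈ φ.cells then T.1 ⟨c, h⟩ else 0, ?_⟩
      invFun := fun T => ⟨fun c => T.1 c, ?_⟩
      left_inv := fun T => Subtype.ext (funext fun c => dif_pos c.2)
      right_inv := fun T => Subtype.ext (funext fun c => ?_) }
  · have hv : ∀ c (hc : c ∈ φ.cells),
        (if h : c ∈ φ.cells then T.1 ⟨c, h⟩ else 0) = T.1 ⟨c, hc⟩ := fun c hc => dif_pos hc
    refine ⟨fun c hc => dif_neg hc, ?_, ?_, ?_, ?_⟩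
    · intro c hc d hd h
      simp only at h
      rw [hv c hc, hv d hd] at h
      exact congrArg Subtype.val (T.2.injective h)
    · have := T.2.range_eq
      rw [SkewFerrersShape.area] at this
      rw [← this]
      ext x
      constructor
      · rintro ⟨c, hc, rfl⟩
        exact ⟨⟨c, hc⟩, (hv c hc).symm⟩
      · rintro ⟨c, rfl⟩
        exact ⟨c, c.2, hv c c.2⟩
    · intro c hc d hd
      rw [hv c hc, hv d hd]
      exact T.2.row_decreasing ⟨c, hc⟩ ⟨d, hd⟩
    · intro c hc d hd
      rw [hv c hc, hv d hd]
      exact T.2.col_decreasing ⟨c, hc⟩ ⟨d, hd⟩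
  · refine ⟨fun c d h => Subtype.ext (T.2.injOn c.2 d.2 h), ?_,
      fun c d => T.2.row_decreasing c c.2 d d.2, fun c d => T.2.col_decreasing c c.2 d d.2⟩
    rw [SkewFerrersShape.area, ← T.2.image_eq]
    ext x
    simp
  · by_cases hc : c ∈ φ.cells
    · exact dif_pos hc
    · simp only [dif_neg hc]
      exact (T.2.eq_zero c hc).symm

open Classical in
/-- The cells of `S` with no cell of `S` to their right or below them. -/
def corners (S : Finset (ℕ × ℕ)) : Finset (ℕ × ℕ) :=
  S.filter fun c => ∀ d ∈ S, ¬ (c.1 = d.1 ∧ c.2 < d.2) ∧ ¬ (c.2 = d.2 ∧ c.1 < d.1)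

theorem mem_corners {S : Finset (ℕ × ℕ)} {c : ℕ × ℕ} :
    c ∈ corners S ↔ c ∈ S ∧ ∀ d ∈ S, ¬ (c.1 = d.1 ∧ c.2 < d.2) ∧ ¬ (c.2 = d.2 ∧ c.1 < d.1) := by
  simp [corners]

/-- Adding 1 throughout `S` gives the corner `c` the entry 1, since a filling of `S.erase c` is 0 at
`c`. -/
theorem IsFilling.add_one {S : Finset (ℕ × ℕ)} {c : ℕ × ℕ} (hc : c ∈ corners S)
    {T : ℕ × ℕ → ℕ} (hT : IsFilling (S.erase c) T) :
    IsFilling S fun x => if x ∈ S then T x + 1 else 0 := by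
  obtain ⟨hcS, hcm⟩ := mem_corners.1 hc
  have hTc : T c = 0 := hT.eq_zero c (notMem_erase c S)
  have hpos : ∀ x ∈ S, x ≠ c → 1 ≤ T x ∧ T x ≤ #(S.erase c) := fun x hx hxc =>
    hT.mem_Icc (mem_erase.2 ⟨hxc, hx⟩)
  have hcard : #(S.erase c) + 1 = #S := card_erase_add_one hcS
  refine ⟨fun x hx => if_neg hx, ?_, ?_, ?_, ?_⟩
  · intro x hx y hy h
    have hx : x ∈ S := hx
    have hy : y ∈ S := hy
    simp only [if_pos hx, if_pos hy, Nat.add_right_cancel_iff] at h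
    by_cases hxc : x = c
    · by_contra hne
      have := hpos y hy fun e => hne (hxc.trans e.symm)
      rw [← h, hxc] at this
      omega
    · by_cases hyc : y = c
      · have := hpos x hx hxc
        rw [h, hyc] at this
        omega
      · exact hT.injOn (mem_coe.2 (mem_erase.2 ⟨hxc, hx⟩)) (mem_coe.2 (mem_erase.2 ⟨hyc, hy⟩)) h
  · ext k
    constructor
    · rintro ⟨x, hx, rfl⟩
      have hx : x ∈ S := hx
      simp only [if_pos hx, Set.mem_Icc]
      by_cases hxc : x = c
      · rw [hxc, hTc]; omega
      · have := hpos x hx hxc; omega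
    · rintro ⟨h1, h2⟩
      by_cases hk : k = 1
      · exact ⟨c, hcS, by simp [hcS, hTc, hk]⟩
      · have : k - 1 ∈ Set.Icc 1 #(S.erase c) := ⟨by omega, by omega⟩
        rw [← hT.image_eq] at this
        obtain ⟨x, hx, hxk⟩ := this
        have hxS : x ∈ S := mem_of_mem_erase (mem_coe.1 hx)
        exact ⟨x, hxS, by simp only [if_pos hxS, hxk]; omega⟩
  · intro x hx y hy h1 h2
    simp only [if_pos hx, if_pos hy]
    have hxc : x ≠ c := fun e => (hcm y hy).1 (e ▸ ⟨h1, h2⟩)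
    by_cases hyc : y = c
    · have := hpos x hx hxc
      rw [hyc, hTc]; omega
    · have := hT.row_decreasing x (mem_erase.2 ⟨hxc, hx⟩) y (mem_erase.2 ⟨hyc, hy⟩) h1 h2
      omega
  · intro x hx y hy h1 h2
    simp only [if_pos hx, if_pos hy]
    have hxc : x ≠ c := fun e => (hcm y hy).2 (e ▸ ⟨h1, h2⟩)
    by_cases hyc : y = c
    · have := hpos x hx hxc
      rw [hyc, hTc]; omega
    · have := hT.col_decreasing x (mem_erase.2 ⟨hxc, hx⟩) y (mem_erase.2 ⟨hyc, hy⟩) h1 h2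
      omega

theorem IsFilling.sub_one {S : Finset (ℕ × ℕ)} {c : ℕ × ℕ} {T : ℕ × ℕ → ℕ}
    (hT : IsFilling S T) (hcS : c ∈ S) (hc : T c = 1) :
    IsFilling (S.erase c) fun x => T x - 1 := by
  have hpos : ∀ x ∈ S.erase c, 2 ≤ T x ∧ T x ≤ #S := by
    intro x hx
    obtain ⟨hxc, hx⟩ := mem_erase.1 hx
    have h1 := hT.mem_Icc hx
    have h2 : T x ≠ 1 := fun h => hxc (hT.injOn hx hcS (h.trans hc.symm))
    omega
  have hcard : #(S.erase c) + 1 = #S := card_erase_add_one hcS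
  refine ⟨?_, ?_, ?_, ?_, ?_⟩
  · intro x hx
    by_cases hxc : x = c
    · rw [hxc, hc]
    · rw [hT.eq_zero x fun h => hx (mem_erase.2 ⟨hxc, h⟩)]
  · intro x hx y hy h
    simp only at h
    have h1 := hpos x hx
    have h2 := hpos y hy
    exact hT.injOn (mem_of_mem_erase hx) (mem_of_mem_erase hy) (by omega)
  · ext k
    constructor
    · rintro ⟨x, hx, rfl⟩
      have := hpos x hx
      simp only [Set.mem_Icc]
      omega
    · rintro ⟨h1, h2⟩
      have : k + 1 ∈ Set.Icc 1 #S := ⟨by omega, by omega⟩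
      rw [← hT.image_eq] at this
      obtain ⟨x, hx, hxk⟩ := this
      refine ⟨x, mem_coe.2 (mem_erase.2 ⟨?_, hx⟩), by simp [hxk]⟩
      rintro rfl
      omega
  · intro x hx y hy h1 h2
    have := hT.row_decreasing x (mem_of_mem_erase hx) y (mem_of_mem_erase hy) h1 h2
    have := hpos y hy
    omega
  · intro x hx y hy h1 h2
    have := hT.col_decreasing x (mem_of_mem_erase hx) y (mem_of_mem_erase hy) h1 h2
    have := hpos y hy
    omega

/-- The entry 1 sits in a corner because the rows and columns decrease; delete that cell and lower
the other entries by 1. -/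
theorem fillingCount_eq_sum {S : Finset (ℕ × ℕ)} (hS : S.Nonempty) :
    fillingCount S = ∑ c ∈ corners S, fillingCount (S.erase c) := by
  let f : (Σ c : corners S, {T : ℕ × ℕ → ℕ // IsFilling (S.erase c.1) T}) →
      {T : ℕ × ℕ → ℕ // IsFilling S T} :=
    fun x => ⟨fun y => if y ∈ S then x.2.1 y + 1 else 0, x.2.2.add_one x.1.2⟩
  have hf : Function.Bijective f := by
    constructor
    · rintro ⟨⟨c, hc⟩, T, hT⟩ ⟨⟨d, hd⟩, T', hT'⟩ h
      have h' : ∀ x ∈ S, T x = T' x := by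
        intro x hx
        have := congrFun (congrArg Subtype.val h) x
        simpa [f, hx] using this
      simp only at hT hT'
      have hcS := (mem_corners.1 hc).1
      have hcd : c = d := by
        by_contra hne
        have h1 := hT'.mem_Icc (mem_erase.2 ⟨hne, hcS⟩)
        rw [← h' c hcS, hT.eq_zero c (notMem_erase c S)] at h1
        omega
      subst hcd
      have : T = T' := by
        funext x
        by_cases hx : x ∈ S
        · exact h' x hx
        · rw [hT.eq_zero x fun hm => hx (mem_of_mem_erase hm),
            hT'.eq_zero x fun hm => hx (mem_of_mem_erase hm)]
      subst this
      rfl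
    · rintro ⟨T, hT⟩
      have : 1 ∈ Set.Icc 1 #S := ⟨le_rfl, card_pos.2 hS⟩
      rw [← hT.image_eq] at this
      obtain ⟨c, hc, hc1⟩ := this
      have hcor : c ∈ corners S := by
        refine mem_corners.2 ⟨hc, fun d hd => ⟨fun hcd => ?_, fun hcd => ?_⟩⟩
        · have h1 := hT.row_decreasing c hc d hd hcd.1 hcd.2
          have h2 := hT.mem_Icc hd
          omega
        · have h1 := hT.col_decreasing c hc d hd hcd.1 hcd.2
          have h2 := hT.mem_Icc hd
          omega
      refine ⟨⟨⟨c, hcor⟩, _, hT.sub_one hc hc1⟩, Subtype.ext (funext fun x => ?_)⟩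
      simp only [f]
      split_ifs with hx
      · have := hT.mem_Icc hx
        omega
      · exact (hT.eq_zero x hx).symm
  rw [fillingCount, ← Nat.card_congr (Equiv.ofBijective f hf), Nat.card_sigma]
  exact sum_coe_sort (corners S) fun c => fillingCount (S.erase c)

/-! ### The cells above a path -/

/-- The cells that lie above the path `v`, in the box spanned by `v`. -/
def cellsAbove (v : List DyckStep) : Finset (ℕ × ℕ) :=
  (range (v.count DyckStep.U) ×ˢ range v.length).filter fun c =>
    c.2 < (v.take (c.2 + v.count DyckStep.U - c.1)).count DyckStep.D

/-- Write `r` for the number of up steps. The lower right vertex of the cell `(i, j)` is `j + 1` to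
the right of and `r - i - 1` above the start of `v`. The path reaches its antidiagonal after `j + r
- i` steps, and the cell is above the path when those steps have gone right more than `j` times. -/
theorem mem_cellsAbove {v : List DyckStep} {i j : ℕ} :
    (i, j) ∈ cellsAbove v ↔ i < v.count DyckStep.U ∧
      j < (v.take (j + v.count DyckStep.U - i)).count DyckStep.D := by
  simp only [cellsAbove, mem_filter, mem_product, mem_range]
  constructor
  · rintro ⟨⟨h1, -⟩, h2⟩
    exact ⟨h1, h2⟩
  · rintro ⟨h1, h2⟩
    refine ⟨⟨h1, h2.trans_le ?_⟩, h2⟩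
    exact ((List.take_sublist _ _).count_le _).trans List.count_le_length

theorem count_take_mono (v : List DyckStep) (s : DyckStep) {a b : ℕ} (h : a ≤ b) :
    (v.take a).count s ≤ (v.take b).count s :=
  (List.take_sublist_take_left h).count_le s

theorem isLowerSet_cellsAbove (v : List DyckStep) : IsLowerSet (cellsAbove v : Set (ℕ × ℕ)) := by
  have hrow : ∀ i j, (i, j + 1) ∈ cellsAbove v → (i, j) ∈ cellsAbove v := by
    intro i j h
    rw [mem_cellsAbove] at h ⊢
    refine ⟨h.1, ?_⟩
    have h2 := h.2
    rw [show j + 1 + v.count DyckStep.U - i = j + v.count DyckStep.U - i + 1 by omega,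
      count_take_succ] at h2
    split_ifs at h2 <;> omega
  have hcol : ∀ i j, (i + 1, j) ∈ cellsAbove v → (i, j) ∈ cellsAbove v := by
    intro i j h
    rw [mem_cellsAbove] at h ⊢
    exact ⟨by omega, h.2.trans_le (count_take_mono v _ (by omega))⟩
  have hrow' : ∀ k i j, (i, j + k) ∈ cellsAbove v → (i, j) ∈ cellsAbove v := by
    intro k
    induction k with
    | zero => intro i j h; exact h
    | succ k ih => intro i j h; exact ih i j (hrow _ _ h)
  have hcol' : ∀ k i j, (i + k, j) ∈ cellsAbove v → (i, j) ∈ cellsAbove v := by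
    intro k
    induction k with
    | zero => intro i j h; exact h
    | succ k ih => intro i j h; exact ih i j (hcol _ _ h)
  rintro ⟨a, b⟩ ⟨i, j⟩ ⟨h1, h2⟩ h
  obtain ⟨k, rfl⟩ := Nat.exists_eq_add_of_le h1
  obtain ⟨l, rfl⟩ := Nat.exists_eq_add_of_le h2
  exact hcol' k _ _ (hrow' l _ _ h)

/-- The cell that is lost when the valley of `v` at position `q` is flipped. -/
def valleyCell (v : List DyckStep) (q : ℕ) : ℕ × ℕ :=
  ((v.take q).count DyckStep.D + v.count DyckStep.U - (q + 1), (v.take q).count DyckStep.D)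

/-- Ensures that the subtraction in `valleyCell` does not truncate: the up step of the valley is not
among the first `q` steps. -/
theorem count_U_take_lt {v : List DyckStep} {q : ℕ} (hq : IsValley v q) :
    q + 1 ≤ (v.take q).count DyckStep.D + v.count DyckStep.U := by
  have h1 := count_U_add_count_D (v.take q)
  have h2 := count_take_succ v DyckStep.U (q + 1)
  have h3 := count_take_mono v DyckStep.U (Nat.le_succ q)
  have h4 := (List.take_sublist (q + 1 + 1) v).count_le DyckStep.U
  have h5 := hq.lt
  rw [List.length_take, min_eq_left (by omega)] at h1
  rw [hq.2, if_pos rfl] at h2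
  rw [Nat.succ_eq_add_one] at h3
  omega

theorem valleyCell_diagonal {v : List DyckStep} {q : ℕ} (hq : IsValley v q) :
    (valleyCell v q).2 + v.count DyckStep.U = (valleyCell v q).1 + q + 1 := by
  have := count_U_take_lt hq
  simp only [valleyCell]
  omega

theorem count_D_take_of_isValley {v : List DyckStep} {q : ℕ} (hq : IsValley v q) :
    (v.take (q + 1)).count DyckStep.D = (valleyCell v q).2 + 1 ∧
      (v.take (q + 1 + 1)).count DyckStep.D = (valleyCell v q).2 + 1 := by
  rw [count_take_succ v _ (q + 1), count_take_succ, hq.1, hq.2]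
  simp [valleyCell]

theorem count_D_take_le (v : List DyckStep) (q : ℕ) : (v.take q).count DyckStep.D ≤ q :=
  List.count_le_length.trans (List.length_take_le q v)

theorem valleyCell_mem {v : List DyckStep} {q : ℕ} (hq : IsValley v q) :
    valleyCell v q ∈ cellsAbove v := by
  have h1 := valleyCell_diagonal hq
  have h2 := count_D_take_of_isValley hq
  have h3 : (valleyCell v q).2 ≤ q := count_D_take_le v q
  rw [← Prod.mk.eta (p := valleyCell v q), mem_cellsAbove,
    show (valleyCell v q).2 + v.count DyckStep.U - (valleyCell v q).1 = q + 1 by omega]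
  omega

theorem count_U_flipAt {v : List DyckStep} {q : ℕ} (hq : IsValley v q) :
    (flipAt v q).count DyckStep.U = v.count DyckStep.U := by
  have h1 := count_D_take_flipAt hq v.length
  have h2 := hq.lt
  have h3 := count_U_add_count_D v
  have h4 := count_U_add_count_D (flipAt v q)
  rw [List.take_length, List.take_of_length_le (by rw [length_flipAt]), if_neg (by omega)] at h1
  rw [length_flipAt] at h4
  omega

theorem cellsAbove_flipAt {v : List DyckStep} {q : ℕ} (hq : IsValley v q) :
    cellsAbove (flipAt v q) = (cellsAbove v).erase (valleyCell v q) := by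
  have h1 := valleyCell_diagonal hq
  have h2 := count_D_take_of_isValley hq
  have h3 : (valleyCell v q).2 ≤ q := count_D_take_le v q
  ext ⟨i, j⟩
  have h5 := count_D_take_flipAt hq (j + v.count DyckStep.U - i)
  rw [mem_erase, mem_cellsAbove, mem_cellsAbove, count_U_flipAt hq, ne_eq, Prod.ext_iff]
  simp only
  by_cases h4 : j + v.count DyckStep.U - i = q + 1
  · rw [h4] at h5 ⊢
    rw [if_pos rfl] at h5
    omega
  · rw [if_neg h4] at h5
    omega

/-- As `I` is a lower set, the right and lower neighbours of a corner outside `I` are missing from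
`cellsAbove v` itself. This pins down the two steps of `v` around the corner as a valley. -/
theorem mem_corners_sdiff_iff {v : List DyckStep} {I : Finset (ℕ × ℕ)}
    (hI : IsLowerSet (I : Set (ℕ × ℕ))) {c : ℕ × ℕ} :
    c ∈ corners (cellsAbove v \ I) ↔ ∃ q, IsValley v q ∧ valleyCell v q ∉ I ∧ valleyCell v q = c := by
  have hO := isLowerSet_cellsAbove v
  constructor
  · obtain ⟨i, j⟩ := c
    intro hc
    obtain ⟨hS, hm⟩ := mem_corners.1 hc
    obtain ⟨hcO, hcI⟩ := mem_sdiff.1 hS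
    have hout : ∀ d, (i, j) ≤ d → d ∉ cellsAbove v \ I → d ∉ cellsAbove v := by
      intro d hd hdS hdO
      exact hdS (mem_sdiff.2 ⟨hdO, fun hdI => hcI (hI hd hdI)⟩)
    have h1 : (i, j + 1) ∉ cellsAbove v :=
      hout _ ⟨le_rfl, Nat.le_succ j⟩ fun h => (hm _ h).1 ⟨rfl, Nat.lt_succ_self j⟩
    have h2 : (i + 1, j) ∉ cellsAbove v :=
      hout _ ⟨Nat.le_succ i, le_rfl⟩ fun h => (hm _ h).2 ⟨rfl, Nat.lt_succ_self i⟩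
    rw [mem_cellsAbove] at hcO h1 h2
    obtain ⟨q, hq⟩ : ∃ q, j + v.count DyckStep.U - i = q + 1 :=
      ⟨j + v.count DyckStep.U - i - 1, by omega⟩
    rw [show j + 1 + v.count DyckStep.U - i = q + 1 + 1 by omega] at h1
    rw [show j + v.count DyckStep.U - (i + 1) = q by omega] at h2
    rw [hq] at hcO
    -- Needed in the bottom row, where `h2` holds for lack of a row `i + 1`; there `q = j`.
    have h3 := count_D_take_le v q
    have h4 : (v.take q).count DyckStep.D = j ∧ v[q]? = some DyckStep.D := by
      have := count_take_succ v DyckStep.D q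
      split_ifs at this with hD
      · exact ⟨by omega, hD⟩
      · omega
    have h5 : v[q + 1]? = some DyckStep.U := by
      have h6 := count_take_succ v DyckStep.D (q + 1)
      rcases hg : v[q + 1]? with _ | _ | _
      · rw [List.getElem?_eq_none_iff] at hg
        have h7 := count_U_add_count_D v
        rw [List.take_of_length_le hg] at hcO
        omega
      · rfl
      · rw [hg, if_pos rfl] at h6
        omega
    have hv : valleyCell v q = (i, j) := by
      rw [valleyCell, h4.1]
      exact Prod.ext (by simp only; omega) rfl
    exact ⟨q, ⟨h4.2, h5⟩, hv ▸ hcI, hv⟩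
  · rintro ⟨q, hq, hqI, rfl⟩
    have h1 := valleyCell_diagonal hq
    have h2 := count_D_take_of_isValley hq
    have h3 : (valleyCell v q).2 ≤ q := count_D_take_le v q
    have h4 : (valleyCell v q).2 = (v.take q).count DyckStep.D := rfl
    refine mem_corners.2 ⟨mem_sdiff.2 ⟨valleyCell_mem hq, hqI⟩, fun d hd => ⟨?_, ?_⟩⟩
    · rintro ⟨h5, h6⟩
      have h7 : ((valleyCell v q).1, (valleyCell v q).2 + 1) ∈ cellsAbove v :=
        hO (a := d) ⟨h5.le, h6⟩ (mem_sdiff.1 hd).1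
      rw [mem_cellsAbove, show (valleyCell v q).2 + 1 + v.count DyckStep.U - (valleyCell v q).1 =
        q + 1 + 1 by omega] at h7
      omega
    · rintro ⟨h5, h6⟩
      have h7 : ((valleyCell v q).1 + 1, (valleyCell v q).2) ∈ cellsAbove v :=
        hO (a := d) ⟨h6, h5.le⟩ (mem_sdiff.1 hd).1
      rw [mem_cellsAbove, show (valleyCell v q).2 + v.count DyckStep.U - ((valleyCell v q).1 + 1) =
        q by omega] at h7
      omega

open Classical in
/-- The lower sets `I` of cells such that `m` cells lie between `v` and `I`, at least one of them
on each of the diagonals with number in `R`. -/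
def innerSets (v : List DyckStep) (m : ℕ) (R : Finset ℕ) : Finset (Finset (ℕ × ℕ)) :=
  (cellsAbove v).powerset.filter fun I => IsLowerSet (I : Set (ℕ × ℕ)) ∧
    #(cellsAbove v \ I) = m ∧
    ∀ q ∈ R, ∃ c ∈ cellsAbove v \ I, c.2 + v.count DyckStep.U = c.1 + q + 1

theorem mem_innerSets {v : List DyckStep} {m : ℕ} {R : Finset ℕ} {I : Finset (ℕ × ℕ)} :
    I ∈ innerSets v m R ↔ I ⊆ cellsAbove v ∧ IsLowerSet (I : Set (ℕ × ℕ)) ∧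
      #(cellsAbove v \ I) = m ∧
      ∀ q ∈ R, ∃ c ∈ cellsAbove v \ I, c.2 + v.count DyckStep.U = c.1 + q + 1 := by
  simp only [innerSets, mem_filter, mem_powerset]

/-- The flip removes one cell, and that cell settles the requirement on diagonal `q` and on no other
diagonal. -/
theorem mem_innerSets_flipAt {v : List DyckStep} {q : ℕ} (hq : IsValley v q) {m : ℕ}
    {R : Finset ℕ} {I : Finset (ℕ × ℕ)} :
    I ∈ innerSets (flipAt v q) m (R.erase q) ↔ valleyCell v q ∉ I ∧ I ∈ innerSets v (m + 1) R := by
  have hd := valleyCell_diagonal hq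
  rw [mem_innerSets, mem_innerSets, cellsAbove_flipAt hq, count_U_flipAt hq, subset_erase,
    erase_sdiff_comm]
  by_cases hqI : valleyCell v q ∈ I
  · simp [hqI]
  have hc : valleyCell v q ∈ cellsAbove v \ I := mem_sdiff.2 ⟨valleyCell_mem hq, hqI⟩
  have hcard := card_erase_add_one hc
  have hdiag : (∀ p ∈ R.erase q, ∃ c ∈ (cellsAbove v \ I).erase (valleyCell v q),
      c.2 + v.count DyckStep.U = c.1 + p + 1) ↔
      ∀ p ∈ R, ∃ c ∈ cellsAbove v \ I, c.2 + v.count DyckStep.U = c.1 + p + 1 := by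
    constructor
    · intro h p hp
      by_cases hpq : p = q
      · subst hpq
        exact ⟨_, hc, hd⟩
      · obtain ⟨c, hcm, hce⟩ := h p (mem_erase.2 ⟨hpq, hp⟩)
        exact ⟨c, mem_of_mem_erase hcm, hce⟩
    · intro h p hp
      obtain ⟨hpq, hp⟩ := mem_erase.1 hp
      obtain ⟨c, hcm, hce⟩ := h p hp
      refine ⟨c, mem_erase.2 ⟨?_, hcm⟩, hce⟩
      rintro rfl
      omega
  rw [hdiag, ← hcard]
  simp [hqI]

/-- A flip sequence peels off the cells between `v` and a lower set `I`, the cell of the first flip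
carrying the entry 1. Both sides obey the recursion on this first cell. -/
theorem flipCount_eq_sum_innerSets (m : ℕ) : ∀ (v : List DyckStep) (R : Finset ℕ),
    flipCount ∅ m v R = ∑ I ∈ innerSets v m R, fillingCount (cellsAbove v \ I) := by
  classical
  induction m with
  | zero =>
    intro v R
    rw [flipCount]
    have hI : ∀ I ∈ innerSets v 0 R, cellsAbove v \ I = ∅ ∧ R = ∅ ∧ I = cellsAbove v := by
      intro I hI
      obtain ⟨h1, -, h2, h3⟩ := mem_innerSets.1 hI
      rw [card_eq_zero] at h2
      refine ⟨h2, eq_empty_of_forall_notMem fun q hq => ?_,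
        h1.antisymm (sdiff_eq_empty_iff_subset.1 h2)⟩
      obtain ⟨c, hc, -⟩ := h3 q hq
      rw [h2] at hc
      exact notMem_empty c hc
    split_ifs with hR
    · have : innerSets v 0 R = {cellsAbove v} := by
        ext I
        rw [mem_singleton]
        refine ⟨fun h => (hI I h).2.2, ?_⟩
        rintro rfl
        rw [mem_innerSets]
        exact ⟨Subset.rfl, isLowerSet_cellsAbove v, by simp, by simp [hR]⟩
      rw [this, sum_singleton, sdiff_self, bot_eq_empty, fillingCount_empty]
    · rw [eq_empty_of_forall_notMem fun I h => hR (hI I h).2.1, sum_empty]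
  | succ m ih =>
    intro v R
    have hrec : ∀ I ∈ innerSets v (m + 1) R, fillingCount (cellsAbove v \ I) =
        ∑ q ∈ valleys v with valleyCell v q ∉ I,
          fillingCount ((cellsAbove v \ I).erase (valleyCell v q)) := by
      intro I hI
      obtain ⟨h1, h2, h3, -⟩ := mem_innerSets.1 hI
      rw [fillingCount_eq_sum (card_pos.1 (by omega))]
      symm
      refine sum_bij (fun q _ => valleyCell v q) ?_ ?_ ?_ ?_
      · intro q hq
        rw [mem_filter, mem_valleys] at hq
        exact (mem_corners_sdiff_iff h2).2 ⟨q, hq.1, hq.2, rfl⟩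
      · intro q hq q' hq' he
        rw [mem_filter, mem_valleys] at hq hq'
        have e1 := valleyCell_diagonal hq.1
        have e2 := valleyCell_diagonal hq'.1
        rw [he] at e1
        omega
      · intro c hc
        obtain ⟨q, hq, hqI, rfl⟩ := (mem_corners_sdiff_iff h2).1 hc
        exact ⟨q, mem_filter.2 ⟨mem_valleys.2 hq, hqI⟩, rfl⟩
      · intro q _
        rfl
    rw [sum_congr rfl hrec, flipCount, sdiff_empty]
    simp only [ih]
    rw [sum_comm' (t' := valleys v) (s' := fun q => innerSets (flipAt v q) m (R.erase q))]
    · refine sum_congr rfl fun q hq => sum_congr rfl fun I hI => ?_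
      rw [cellsAbove_flipAt (mem_valleys.1 hq), erase_sdiff_comm]
    · intro I q
      constructor
      · rintro ⟨hI, hq⟩
        rw [mem_filter] at hq
        exact ⟨(mem_innerSets_flipAt (mem_valleys.1 hq.1)).2 ⟨hq.2, hI⟩, hq.1⟩
      · rintro ⟨hI, hq⟩
        have := (mem_innerSets_flipAt (mem_valleys.1 hq)).1 hI
        exact ⟨this.2, mem_filter.2 ⟨hq, this.1⟩⟩

/-! ### Skew Ferrers shapes on a given border -/

/-- Locates the vertical step of the `k`-th row from the bottom: `l[k] - p` horizontal and `k`
vertical steps precede it. -/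
theorem count_U_take_borderWord (l : List ℕ) : ∀ (p k : ℕ), (p :: l).Pairwise (· ≤ ·) →
    ∀ hk : k < l.length,
      ((borderWord p l).take (l[k] - p + k)).count DyckStep.U = k ∧
      ((borderWord p l).take (l[k] - p + k + 1)).count DyckStep.U = k + 1 := by
  induction l with
  | nil => intro p k _ hk; simp at hk
  | cons r rs ih =>
    intro p k hp hk
    obtain ⟨hp1, hp2⟩ := List.pairwise_cons.1 hp
    have hpr := hp1 r List.mem_cons_self
    rcases k with _ | k
    · simp [borderWord, List.take_append, List.count_append, List.count_replicate]
    · have hk' : k < rs.length := by simpa using hk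
      have h1 := (List.pairwise_cons.1 hp2).1 rs[k] (List.getElem_mem _)
      have h2 := ih r k hp2 hk'
      have e : ∀ t, ((borderWord p (r :: rs)).take (r - p + 1 + t)).count DyckStep.U =
          1 + ((borderWord r rs).take t).count DyckStep.U := by
        intro t
        rw [borderWord, List.take_append, List.length_replicate,
          show r - p + 1 + t - (r - p) = t + 1 by omega, List.take_succ_cons, List.count_append,
          List.count_cons_self, List.take_of_length_le (by simp; omega), List.count_replicate]
        simp [add_comm]
      rw [List.getElem_cons_succ,
        show rs[k] - p + (k + 1) = r - p + 1 + (rs[k] - r + k) by omega, e,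
        show r - p + 1 + (rs[k] - r + k) + 1 = r - p + 1 + (rs[k] - r + k + 1) by omega, e]
      omega

theorem count_D_borderWord_le (l : List ℕ) : ∀ (p B : ℕ), (p :: l).Pairwise (· ≤ ·) → p ≤ B →
    (∀ r ∈ l, r ≤ B) → p + (borderWord p l).count DyckStep.D ≤ B := by
  induction l with
  | nil => intro p B _ h _; simpa [borderWord] using h
  | cons r rs ih =>
    intro p B hp _ hB
    obtain ⟨hp1, hp2⟩ := List.pairwise_cons.1 hp
    have hpr := hp1 r List.mem_cons_self
    have := ih r B hp2 (hB r List.mem_cons_self) fun x hx => hB x (List.mem_cons_of_mem r hx)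
    simp only [borderWord, List.count_append, List.count_replicate_self, List.count_cons]
    simp only [beq_iff_eq, reduceCtorEq, if_false]
    omega

namespace YoungDiagram

/-- The word of the boundary of a Young diagram. -/
def boundaryWord (o : YoungDiagram) : List DyckStep := borderWord 0 o.rowLens.reverse

variable (o : YoungDiagram)

theorem pairwise_zero_cons_rowLens_reverse : (0 :: o.rowLens.reverse).Pairwise (· ≤ ·) := by
  rw [List.pairwise_cons]
  refine ⟨fun _ _ => Nat.zero_le _, ?_⟩
  rw [List.pairwise_reverse]
  exact o.rowLens_sorted.pairwise

theorem count_U_boundaryWord : o.boundaryWord.count DyckStep.U = o.colLen 0 := by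
  rw [boundaryWord, count_U_borderWord, List.length_reverse, length_rowLens]

theorem count_D_boundaryWord_le : o.boundaryWord.count DyckStep.D ≤ o.rowLen 0 := by
  have := count_D_borderWord_le o.rowLens.reverse 0 (o.rowLen 0)
    o.pairwise_zero_cons_rowLens_reverse (Nat.zero_le _) (by
      intro r hr
      rw [List.mem_reverse] at hr
      obtain ⟨i, hi, rfl⟩ := List.getElem_of_mem hr
      rw [get_rowLens]
      exact o.rowLen_anti _ _ (Nat.zero_le i))
  rw [boundaryWord]
  omega

/-- Row `i` is number `o.colLen 0 - 1 - i` from the bottom. A cell of that row is above the path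
exactly when its antidiagonal is reached no later than the start of the vertical step closing the
row. -/
theorem cellsAbove_boundaryWord : cellsAbove o.boundaryWord = o.cells := by
  ext ⟨i, j⟩
  rw [mem_cellsAbove, count_U_boundaryWord, mem_cells]
  by_cases hi : i < o.colLen 0
  swap
  · refine ⟨fun h => absurd h.1 hi, fun h => absurd ?_ hi⟩
    exact mem_iff_lt_colLen.1 (o.up_left_mem le_rfl (Nat.zero_le j) h)
  rw [mem_iff_lt_rowLen, and_iff_right hi]
  have hlen : o.rowLens.reverse.length = o.colLen 0 := by
    rw [List.length_reverse, length_rowLens]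
  have hk : o.colLen 0 - 1 - i < o.rowLens.reverse.length := by omega
  have hget : o.rowLens.reverse[o.colLen 0 - 1 - i] = o.rowLen i := by
    rw [List.getElem_reverse, get_rowLens, length_rowLens]
    congr 1
    omega
  obtain ⟨h1, h2⟩ :=
    count_U_take_borderWord _ 0 _ o.pairwise_zero_cons_rowLens_reverse hk
  rw [hget, ← boundaryWord, Nat.sub_zero] at h1 h2
  have h3 := count_U_add_count_D (o.boundaryWord.take (j + o.colLen 0 - i))
  rw [List.length_take] at h3
  rcases lt_or_ge j (o.rowLen i) with hj | hj
  · refine ⟨fun _ => hj, fun _ => ?_⟩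
    have h4 := count_take_mono o.boundaryWord DyckStep.U
      (show j + o.colLen 0 - i ≤ o.rowLen i + (o.colLen 0 - 1 - i) by omega)
    have h5 : o.rowLen i + (o.colLen 0 - 1 - i) < o.boundaryWord.length := by
      by_contra! hc
      rw [List.take_of_length_le hc] at h1
      rw [List.take_of_length_le (by omega)] at h2
      omega
    omega
  · refine ⟨fun h => absurd h ?_, fun h => absurd h (by omega)⟩
    have h4 := count_take_mono o.boundaryWord DyckStep.U
      (show o.rowLen i + (o.colLen 0 - 1 - i) + 1 ≤ j + o.colLen 0 - i by omega)
    omega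

end YoungDiagram

/-- The counts are needed: leading up steps and trailing down steps bound no cell. -/
theorem eq_of_cellsAbove_eq {v w : List DyckStep} (hU : v.count DyckStep.U = w.count DyckStep.U)
    (hD : v.count DyckStep.D = w.count DyckStep.D) (h : cellsAbove v = cellsAbove w) : v = w := by
  have hl : v.length = w.length := by rw [← count_U_add_count_D, ← count_U_add_count_D, hU, hD]
  have key : ∀ (x y : List DyckStep), x.count DyckStep.U = y.count DyckStep.U →
      x.length = y.length → cellsAbove x = cellsAbove y →
      ∀ p, (x.take p).count DyckStep.D ≤ (y.take p).count DyckStep.D := by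
    intro x y hxy hlen hc p
    by_contra! hlt
    have h1 := count_U_add_count_D (y.take p)
    have h2 := (List.take_sublist p y).count_le DyckStep.U
    have h3 := count_D_take_le y p
    rw [List.length_take] at h1
    have hp : p ≤ y.length := by
      by_contra! hp
      have h4 : (y.take p).count DyckStep.D = (y.take y.length).count DyckStep.D := by
        rw [List.take_length, List.take_of_length_le hp.le]
      have h5 := count_U_add_count_D x
      have h6 := count_U_add_count_D y
      rw [List.take_of_length_le (l := x) (by omega)] at hlt
      rw [List.take_length] at h4
      omega
    -- The cell just beyond `y` on the antidiagonal reached after `p` steps is above `x` but not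
    -- above `y`.
    have h7 := Finset.ext_iff.1 hc
      ((y.take p).count DyckStep.D + y.count DyckStep.U - p, (y.take p).count DyckStep.D)
    rw [mem_cellsAbove, mem_cellsAbove, hxy, show (y.take p).count DyckStep.D +
      y.count DyckStep.U - ((y.take p).count DyckStep.D + y.count DyckStep.U - p) = p by omega] at h7
    have hy := count_U_add_count_D y
    by_cases h8 : (y.take p).count DyckStep.D + y.count DyckStep.U - p < y.count DyckStep.U
    · have := (h7.1 ⟨h8, hlt⟩).2
      omega
    · have := count_D_take_le x p
      omega
  refine DyckPath.eq_of_pathHeight_eq v w hl fun i => ?_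
  rw [pathHeight_eq, pathHeight_eq, hl,
    (key v w hU hl h i).antisymm (key w v hU.symm hl.symm h.symm i)]

theorem SkewFerrersShape.ext_cells {φ ψ : SkewFerrersShape} (ho : φ.outer.cells = ψ.outer.cells)
    (hi : φ.inner.cells = ψ.inner.cells) : φ = ψ := by
  obtain ⟨o, i, _, _, _, _⟩ := φ
  obtain ⟨o', i', _, _, _, _⟩ := ψ
  obtain rfl : o = o' := YoungDiagram.ext ho
  obtain rfl : i = i' := YoungDiagram.ext hi
  rfl

theorem SkewFerrersShape.cellsAbove_lowerBorder (φ : SkewFerrersShape) :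
    cellsAbove φ.lowerBorder = φ.outer.cells := φ.outer.cellsAbove_boundaryWord

/-- The cells of a skew Ferrers shape meet every diagonal between its lower left and its upper
right corner. -/
theorem SkewFerrersShape.exists_mem_diagonal (φ : SkewFerrersShape) {q : ℕ}
    (hq : q + 1 < φ.outer.colLen 0 + φ.outer.rowLen 0) :
    ∃ c ∈ φ.cells, c.2 + φ.outer.colLen 0 = c.1 + q + 1 := by
  let r := φ.outer.colLen 0
  let S := φ.outer.cells.filter fun c => c.2 + r = c.1 + q + 1
  have hS : S.Nonempty := by
    rcases le_total r (q + 1) with h | h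
    · refine ⟨(0, q + 1 - r), mem_filter.2 ⟨?_, by simp only; omega⟩⟩
      rw [YoungDiagram.mem_cells, YoungDiagram.mem_iff_lt_rowLen]
      omega
    · refine ⟨(r - (q + 1), 0), mem_filter.2 ⟨?_, by simp only; omega⟩⟩
      rw [YoungDiagram.mem_cells, YoungDiagram.mem_iff_lt_colLen]
      by_cases h0 : r = 0
      · omega
      · change r - (q + 1) < r
        omega
  -- The lowest cell of `outer` on the diagonal is the one most likely to avoid `inner`.
  obtain ⟨⟨i, j⟩, hc, hmax⟩ := exists_max_image S Prod.fst hS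
  obtain ⟨hcO, hd⟩ := mem_filter.1 hc
  simp only at hd
  have hout : (i + 1, j + 1) ∉ φ.outer := by
    intro h
    have := hmax (i + 1, j + 1)
      (mem_filter.2 ⟨(YoungDiagram.mem_cells _).2 h, by simp only; omega⟩)
    simp at this
  refine ⟨(i, j), mem_sdiff.2 ⟨hcO, fun hI => ?_⟩, hd⟩
  rw [YoungDiagram.mem_cells] at hI
  by_cases h1 : i + 1 < φ.outer.colLen 0
  · obtain ⟨b, hb1, hb2⟩ := φ.rows_connected i h1
    simp only [mem_sdiff, YoungDiagram.mem_cells] at hb1 hb2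
    rcases le_or_gt b j with hbj | hbj
    · exact hb1.2 (φ.inner.up_left_mem le_rfl hbj hI)
    · exact hout (φ.outer.up_left_mem le_rfl hbj hb2.1)
  by_cases h2 : j + 1 < φ.outer.rowLen 0
  · obtain ⟨a, ha1, ha2⟩ := φ.cols_connected j h2
    simp only [mem_sdiff, YoungDiagram.mem_cells] at ha1 ha2
    rcases le_or_gt a i with hai | hai
    · exact ha1.2 (φ.inner.up_left_mem hai le_rfl hI)
    · exact hout (φ.outer.up_left_mem hai le_rfl ha2.1)
  -- Here `(i, j)` is in the last row and the last column, so `inner` would contain all of `outer`.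
  obtain ⟨⟨a, b⟩, hab⟩ := φ.nonempty
  simp only [mem_sdiff, YoungDiagram.mem_cells] at hab
  have h3 := YoungDiagram.mem_iff_lt_colLen.1 (φ.outer.up_left_mem le_rfl (Nat.zero_le b) hab.1)
  have h4 := YoungDiagram.mem_iff_lt_rowLen.1 (φ.outer.up_left_mem (Nat.zero_le a) le_rfl hab.1)
  exact hab.2 (φ.inner.up_left_mem (by omega) (by omega) hI)

theorem SkewFerrersShape.inner_cells_mem_innerSets (φ : SkewFerrersShape) :
    φ.inner.cells ∈ innerSets φ.lowerBorder φ.area (range (φ.lowerBorder.length - 1)) := by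
  have hU : φ.lowerBorder.count DyckStep.U = φ.outer.colLen 0 := φ.outer.count_U_boundaryWord
  have hD : φ.lowerBorder.count DyckStep.D ≤ φ.outer.rowLen 0 := φ.outer.count_D_boundaryWord_le
  have hl := count_U_add_count_D φ.lowerBorder
  rw [mem_innerSets, φ.cellsAbove_lowerBorder, hU]
  refine ⟨YoungDiagram.cells_subset_iff.2 φ.inner_le, φ.inner.isLowerSet, rfl, fun q hq => ?_⟩
  rw [mem_range] at hq
  exact φ.exists_mem_diagonal (by omega)

/-- Meeting the two extreme diagonals makes `v` the full border of its cells; meeting the others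
connects consecutive rows and columns. -/
theorem exists_skewFerrersShape {v : List DyckStep} {m : ℕ} (hm : m ≠ 0) {I : Finset (ℕ × ℕ)}
    (hI : I ∈ innerSets v m (range (v.length - 1))) :
    ∃ φ : SkewFerrersShape, φ.lowerBorder = v ∧ φ.area = m ∧ φ.inner.cells = I := by
  obtain ⟨hsub, hlow, hcard, hdiag⟩ := mem_innerSets.1 hI
  have hO := isLowerSet_cellsAbove v
  set r := v.count DyckStep.U with hr
  set s := v.count DyckStep.D with hs
  have hlen : r + s = v.length := count_U_add_count_D v
  have hbd : ∀ i j, (i, j) ∈ cellsAbove v → i < r ∧ j < s := by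
    intro i j h
    rw [mem_cellsAbove] at h
    exact ⟨h.1, h.2.trans_le ((List.take_sublist _ _).count_le _)⟩
  have hne : (cellsAbove v \ I).Nonempty := card_pos.1 (by omega)
  have hrs : 0 < r ∧ 0 < s := by
    obtain ⟨⟨i, j⟩, hij⟩ := hne
    have := hbd i j (mem_sdiff.1 hij).1
    omega
  -- Diagonal 0 meets the box only in its lower left cell, and diagonal `r + s - 2` only in its
  -- upper right cell.
  have hcol0 : (r - 1, 0) ∈ cellsAbove v := by
    obtain ⟨⟨i, j⟩, hc, he⟩ := hdiag 0 (mem_range.2 (by omega))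
    have := hbd i j (mem_sdiff.1 hc).1
    simp only at he
    exact hO (a := (i, j)) ⟨by simp only; omega, Nat.zero_le _⟩ (mem_sdiff.1 hc).1
  have hrow0 : (0, s - 1) ∈ cellsAbove v := by
    obtain ⟨⟨i, j⟩, hc, he⟩ := hdiag (r + s - 2) (mem_range.2 (by omega))
    have := hbd i j (mem_sdiff.1 hc).1
    simp only at he
    exact hO (a := (i, j)) ⟨Nat.zero_le _, by simp only; omega⟩ (mem_sdiff.1 hc).1
  let o : YoungDiagram := ⟨cellsAbove v, hO⟩
  have hoc : o.cells = cellsAbove v := rfl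
  have hcolLen : o.colLen 0 = r := by
    have h1 := YoungDiagram.mem_iff_lt_colLen.1 ((YoungDiagram.mem_cells (μ := o) _).1 hcol0)
    have h2 : ¬ r < o.colLen 0 := fun h =>
      absurd (hbd _ _ ((YoungDiagram.mem_cells (μ := o) _).2 (YoungDiagram.mem_iff_lt_colLen.2 h))).1
        (lt_irrefl r)
    omega
  have hrowLen : o.rowLen 0 = s := by
    have h1 := YoungDiagram.mem_iff_lt_rowLen.1 ((YoungDiagram.mem_cells (μ := o) _).1 hrow0)
    have h2 : ¬ s < o.rowLen 0 := fun h =>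
      absurd (hbd _ _ ((YoungDiagram.mem_cells (μ := o) _).2 (YoungDiagram.mem_iff_lt_rowLen.2 h))).2
        (lt_irrefl s)
    omega
  have hword : o.boundaryWord = v := by
    refine eq_of_cellsAbove_eq (o.count_U_boundaryWord.trans hcolLen) ?_ o.cellsAbove_boundaryWord
    have h1 := o.count_D_boundaryWord_le
    have h2 := hrow0
    rw [← hoc, ← o.cellsAbove_boundaryWord, mem_cellsAbove] at h2
    have h3 := (List.take_sublist (s - 1 + o.boundaryWord.count DyckStep.U - 0)
      o.boundaryWord).count_le DyckStep.D
    omega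
  have hsq : ∀ a b i j, (a, b) ∈ cellsAbove v \ I → a ≤ i → b ≤ j → (i, j) ∉ I :=
    fun a b i j h hi hj hm => (mem_sdiff.1 h).2 (hlow (a := (i, j)) ⟨hi, hj⟩ hm)
  refine ⟨⟨o, ⟨I, hlow⟩, YoungDiagram.cells_subset_iff.1 hsub, hne, ?_, ?_⟩, hword, hcard, rfl⟩
  · intro i hi
    have h1 := YoungDiagram.mem_iff_lt_rowLen (μ := o) (i := i + 1) (j := o.rowLen (i + 1))
    have h2 : o.rowLen (i + 1) ≤ s := hrowLen ▸ o.rowLen_anti _ _ (Nat.zero_le _)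
    -- The diagonal through the cell above the end of row `i + 1`. Its next cell is just past that
    -- row, so any cell of the shape on it lies weakly up-left of the former, which is then outside
    -- `I`.
    obtain ⟨⟨a, b⟩, hab, he⟩ := hdiag (o.rowLen (i + 1) + r - i - 2) (mem_range.2 (by omega))
    have habO : (a, b) ∈ o := (YoungDiagram.mem_cells (μ := o) _).1 (mem_sdiff.1 hab).1
    simp only at he
    rcases le_or_gt a i with hai | hai
    · have h3 : (i + 1, o.rowLen (i + 1) - 1) ∈ o := by
        rw [YoungDiagram.mem_iff_lt_rowLen]; omega
      have h4 : (i, o.rowLen (i + 1) - 1) ∈ o := o.up_left_mem (Nat.le_succ i) le_rfl h3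
      exact ⟨o.rowLen (i + 1) - 1, mem_sdiff.2 ⟨h4, hsq a b _ _ hab hai (by omega)⟩,
        mem_sdiff.2 ⟨h3, hsq a b _ _ hab (by omega) (by omega)⟩⟩
    · exact absurd (h1.1 (o.up_left_mem hai (by omega) habO)) (lt_irrefl _)
  · intro j hj
    have h1 := YoungDiagram.mem_iff_lt_colLen (μ := o) (i := o.colLen (j + 1)) (j := j + 1)
    have h2 : o.colLen (j + 1) ≤ r := hcolLen ▸ o.colLen_anti _ _ (Nat.zero_le _)
    -- Likewise, the diagonal through the cell to the left of the bottom of column `j + 1`.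
    obtain ⟨⟨a, b⟩, hab, he⟩ := hdiag (j + r - o.colLen (j + 1)) (mem_range.2 (by omega))
    have habO : (a, b) ∈ o := (YoungDiagram.mem_cells (μ := o) _).1 (mem_sdiff.1 hab).1
    simp only at he
    rcases le_or_gt b j with hbj | hbj
    · have h3 : (o.colLen (j + 1) - 1, j + 1) ∈ o := by
        rw [YoungDiagram.mem_iff_lt_colLen]; omega
      have h4 : (o.colLen (j + 1) - 1, j) ∈ o := o.up_left_mem le_rfl (Nat.le_succ j) h3
      exact ⟨o.colLen (j + 1) - 1, mem_sdiff.2 ⟨h4, hsq a b _ _ hab (by omega) hbj⟩,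
        mem_sdiff.2 ⟨h3, hsq a b _ _ hab (by omega) (by omega)⟩⟩
    · exact absurd (h1.1 (o.up_left_mem (by omega) hbj habO)) (lt_irrefl _)

/-- With the border fixed, a shape amounts to its inner lower set. Area 0 must be excluded: a single
step has the empty flip sequence but no shape. -/
theorem sum_tableauCount {v : List DyckStep} {m : ℕ} (hm : m ≠ 0) :
    ∑ φ : ShapesOn v m, φ.1.tableauCount = flipCount ∅ m v (range (v.length - 1)) := by
  rw [flipCount_eq_sum_innerSets]
  refine sum_bij (fun φ _ => φ.1.inner.cells) ?_ ?_ ?_ ?_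
  · rintro ⟨φ, rfl, rfl⟩ _
    exact φ.inner_cells_mem_innerSets
  · intro φ _ ψ _ h
    refine Subtype.ext (SkewFerrersShape.ext_cells ?_ h)
    rw [← φ.1.cellsAbove_lowerBorder, ← ψ.1.cellsAbove_lowerBorder, φ.2.1, ψ.2.1]
  · intro I hI
    obtain ⟨φ, h1, h2, h3⟩ := exists_skewFerrersShape hm hI
    exact ⟨⟨φ, h1, h2⟩, mem_univ _, h3⟩
  · rintro ⟨φ, rfl, rfl⟩ _
    rw [φ.tableauCount_eq, φ.cellsAbove_lowerBorder]
    rfl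

/-! ### Assembling the formula -/

theorem properEgf_eq (v : List DyckStep) :
    properEgf v = PowerSeries.mk fun m =>
      ((∑ φ : ShapesOn v m, φ.1.tableauCount : ℕ) : ℚ) / (m.factorial : ℚ) := by
  ext m
  simp only [properEgf, PowerSeries.coeff_mk]
  split_ifs with hm
  · subst hm
    have : IsEmpty (ShapesOn v 0) :=
      ⟨fun φ => absurd φ.2.2 (card_pos.2 φ.1.nonempty).ne'⟩
    simp
  · rw [sum_tableauCount hm]

/-- The multinomial coefficient depends only on the areas, which are the parts of `lam`; the rest is
a product of sums expanded. -/
theorem sum_shapes_eq {w : List DyckStep} {h : ℕ} (lam : h.Partition)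
    (occ : Fin lam.partList.length → Factor w) :
    ((∑ φ : (i : Fin lam.partList.length) → ShapesOn (occ i).word lam.partList[i],
        Nat.multinomial Finset.univ (fun i => (φ i).1.area) * ∏ i, (φ i).1.tableauCount : ℕ) : ℚ) =
      h.factorial * ∏ i, (((∑ φ : ShapesOn (occ i).word lam.partList[i],
        φ.1.tableauCount : ℕ) : ℚ) / (lam.partList[i].factorial : ℚ)) := by
  have h1 : ∀ φ : (i : Fin lam.partList.length) → ShapesOn (occ i).word lam.partList[i],
      Nat.multinomial Finset.univ (fun i => (φ i).1.area) =
        Nat.multinomial Finset.univ fun i : Fin lam.partList.length => lam.partList[i] :=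
    fun φ => Nat.multinomial_congr fun i _ => (φ i).2.2
  have h2 := Nat.multinomial_spec Finset.univ
    fun i : Fin lam.partList.length => lam.partList[i]
  rw [lam.sum_partList] at h2
  have h4 := Fintype.prod_sum fun i (φ : ShapesOn (occ i).word lam.partList[i]) =>
    φ.1.tableauCount
  rw [sum_congr rfl fun φ _ => by rw [h1 φ], ← mul_sum, ← h4, prod_div_distrib,
    ← h2]
  push_cast
  have h3 : (∏ i : Fin lam.partList.length, (lam.partList[i].factorial : ℚ)) ≠ 0 :=
    prod_ne_zero_iff.2 fun i _ => by exact_mod_cast Nat.factorial_ne_zero _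
  field_simp

theorem flipCount_eq_sum_partitions (w : List DyckStep) (h : ℕ) :
    flipCount ∅ h w ∅ = ∑ lam : h.Partition, ∑ occ : PDO w lam,
      ∑ φ : (i : Fin lam.partList.length) → ShapesOn (occ.1 i).word lam.partList[i],
        Nat.multinomial Finset.univ (fun i => (φ i).1.area) * ∏ i, (φ i).1.tableauCount := by
  have hf : (h.factorial : ℚ) ≠ 0 := by exact_mod_cast h.factorial_ne_zero
  have h1 := congrArg (PowerSeries.coeff h) (flipEgf_eq_sum_factorFamilies w)
  simp only [properEgf_eq] at h1
  rw [← sum_PDO_eq_coeff h (fun F m =>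
    ((∑ φ : ShapesOn F.word m, φ.1.tableauCount : ℕ) : ℚ) / (m.factorial : ℚ)), flipEgf,
    PowerSeries.coeff_mk, div_eq_iff hf] at h1
  · have h2 : ((flipCount ∅ h w ∅ : ℕ) : ℚ) = ((∑ lam : h.Partition, ∑ occ : PDO w lam,
        ∑ φ : (i : Fin lam.partList.length) → ShapesOn (occ.1 i).word lam.partList[i],
        Nat.multinomial Finset.univ (fun i => (φ i).1.area) *
          ∏ i, (φ i).1.tableauCount : ℕ) : ℚ) := by
      rw [h1, mul_comm, mul_sum, Nat.cast_sum]
      refine sum_congr rfl fun lam _ => ?_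
      rw [mul_sum, Nat.cast_sum]
      exact sum_congr rfl fun occ _ => (sum_shapes_eq lam occ.1).symm
    exact_mod_cast h2
  · intro F
    have := congrArg (PowerSeries.coeff 0) (properEgf_eq F.word)
    simpa [properEgf] using this.symm
  · intro F m hne
    by_contra hc
    have : IsEmpty (ShapesOn F.word m) := ⟨fun φ => hc ⟨φ.1, φ.2⟩⟩
    exact hne (by simp)

end

theorem mainTheorem1 (n h : ℕ) :
    saturatedChainCount (DyckPath n) h =
      ∑ γ : DyckPath n, ∑ lam : h.Partition, ∑ occ : PDO γ.steps lam,
        ∑ φ : (i : Fin lam.partList.length) → ShapesOn (occ.1 i).word lam.partList[i],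
          Nat.multinomial Finset.univ (fun i => (φ i).1.area) * ∏ i, (φ i).1.tableauCount := by
  rw [saturatedChainCount_dyckPath]
  exact sum_congr rfl fun γ _ => flipCount_eq_sum_partitions γ.steps h
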